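/- Let $X$ be a second countable, locally compact, Hausdorff space and let $\sigma : X \to X$ be a local homeomorphism (not necessarily surjective). Let $$\Gamma=\Gamma(X,\sigma)=\{(x,m,y)\in X\times\mathbb{Z}\times X : \text{there are } k,l\ge 0 \text{ with } \sigma^k(x)=\sigma^l(y) \text{ and } k-l=m\}$$ be the associated groupoid, with unit space $X$ (identify $x$ with $(x,0,x)$), $r(x,m,y)=x$, $s(x,m,y)=y$ and $(x,m,y)(y,n,z)=(x,m+n,z)$, and with the topology that has as a basis the sets $\{(x,k-l,y) : x\in U,\ y\in V,\ \sigma^k(x)=\sigma^l(y)\}$ for $U,V\subseteq X$ open and $k,l\ge 0$. A $\Gamma$-sheaf is a sheaf $A$ of abelian groups over $X$ together with a continuous action of $\Gamma$ on its étale space, where each $\gamma\in\Gamma$ acts by a homomorphism $A_{s(\gamma)}\to A_{r(\gamma)}$; morphisms of $\Gamma$-sheaves are the equivariant morphisms of sheaves. Let $\mathsf{Ab}(\Gamma)$ be the category of $\Gamma$-sheaves, $\mathsf{Ab}(X)$ the category of sheaves of abelian groups over $X$, and $\mathsf{Ab}$ the category of abelian groups. The cocycle functor $Z_\Gamma:\mathsf{Ab}(\Gamma)\to\mathsf{Ab}$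 assigns to $A$ the group of continuous maps $f:\Gamma\to A$ with $f(\gamma)\in A_{r(\gamma)}$ for all $\gamma$ and $f(\gamma_1\gamma_2)=f(\gamma_1)+\gamma_1 f(\gamma_2)$ for all composable $\gamma_1,\gamma_2$. Let $S:\mathsf{Ab}(X)\to\mathsf{Ab}$ be the global section functor, whose $n$-th right derived functor is the sheaf cohomology $H^n(X,\cdot)$. For a $\Gamma$-sheaf $A$ let $\varphi_A: Z_\Gamma(A)\to S(A)$ be the natural homomorphism $\varphi_A(f)(x)=f(x,1,\sigma(x))$. Then $\mathsf{Ab}(\Gamma)$ is an abelian category with enough injectives, so that the right derived functors $Z^n_\Gamma$ of $Z_\Gamma$ are defined, and for every $n\ge 0$ the maps $\varphi$ induce an isomorphism, natural in the $\Gamma$-sheaf $A$, $$Z^n_\Gamma(A)\;\cong\; H^n(X,A).$$ Here "induced" means the following. Let $A\to I^\bullet$ be any injective resolution of $A$ in $\mathsf{Ab}(\Gamma)$ and $A\to J^\bullet$ any injective resolution in $\mathsf{Ab}(X)$ of the underlying sheaf of $A$. Then there is a morphism of complexes of sheaves $I^\bullet\to J^\bullet$ compatible with the maps from $A$, and for every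 such morphism the isomorphism is the composite $$Z^n_\Gamma(A)= H^n(Z_\Gamma(I^\bullet))\xrightarrow{\ H^n(\varphi_{I^\bullet})\ } H^n(S(I^\bullet))\longrightarrow H^n(S(J^\bullet))=H^n(X,A).$$ -/

import Mathlib

open CategoryTheory TopologicalSpace Opposite
open scoped Topology

universe u

namespace LocalHomeoGroupoid

/-- `(x, m, y)` is an arrow of `Γ(X, σ)`: there are `k, l ≥ 0` with `σ^k x = σ^l y` and
`k - l = m`. -/
def IsArrow {X : Type u} (σ : X → X) (x : X) (m : ℤ) (y : X) : Prop :=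
  ∃ k l : ℕ, σ^[k] x = σ^[l] y ∧ (k : ℤ) - (l : ℤ) = m

theorem IsArrow.refl {X : Type u} (σ : X → X) (x : X) : IsArrow σ x 0 x :=
  ⟨0, 0, rfl, by simp⟩

theorem IsArrow.symm {X : Type u} {σ : X → X} {x y : X} {m : ℤ} (h : IsArrow σ x m y) :
    IsArrow σ y (-m) x := by
  obtain ⟨k, l, h, rfl⟩ := h
  exact ⟨l, k, h.symm, by ring⟩

theorem IsArrow.comp {X : Type u} {σ : X → X} {x y z : X} {m n : ℤ}
    (h : IsArrow σ x m y) (h' : IsArrow σ y n z) : IsArrow σ x (m + n) z := by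
  obtain ⟨k, l, h, rfl⟩ := h
  obtain ⟨k', l', h', rfl⟩ := h'
  refine ⟨k' + k, l + l', ?_, by push_cast; ring⟩
  rw [Function.iterate_add_apply, h, ← Function.iterate_add_apply, Nat.add_comm k' l,
    Function.iterate_add_apply, h', ← Function.iterate_add_apply]

theorem IsArrow.shift {X : Type u} (σ : X → X) (x : X) : IsArrow σ x 1 (σ x) :=
  ⟨1, 0, rfl, by simp⟩

/-- The groupoid `Γ = Γ(X, σ)`, as the set of its arrows `γ = (x, m, y)`, with range
`r γ = x` and source `s γ = y`. The unit space is `X`, embedded by `x ↦ (x, 0, x)`. -/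
@[ext]
structure Gamma {X : Type u} (σ : X → X) : Type u where
  r : X
  deg : ℤ
  s : X
  isArrow : IsArrow σ r deg s

namespace Gamma

variable {X : Type u} {σ : X → X}

/-- The unit `(x, 0, x)`. -/
abbrev unit (σ : X → X) (x : X) : Gamma σ := ⟨x, 0, x, IsArrow.refl σ x⟩

/-- The product `(x, m, y) (y, n, z) = (x, m + n, z)`. Every composable pair is of this form. -/
abbrev mul {x y z : X} {m n : ℤ} (h : IsArrow σ x m y) (h' : IsArrow σ y n z) : Gamma σ :=
  ⟨x, m + n, z, h.comp h'⟩

/-- The inverse `(x, m, y)⁻¹ = (y, -m, x)`. -/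
abbrev inv (γ : Gamma σ) : Gamma σ := ⟨γ.s, -γ.deg, γ.r, γ.isArrow.symm⟩

/-- The arrow `(x, 1, σ x)`. -/
abbrev shift (σ : X → X) (x : X) : Gamma σ := ⟨x, 1, σ x, IsArrow.shift σ x⟩

/-- The set of the `(x, k - l, y)` with `x ∈ U`, `y ∈ V` and `σ^k x = σ^l y`. -/
def basicSet (σ : X → X) (U : Set X) (k l : ℕ) (V : Set X) : Set (Gamma σ) :=
  {γ | γ.r ∈ U ∧ γ.s ∈ V ∧ σ^[k] γ.r = σ^[l] γ.s ∧ (k : ℤ) - (l : ℤ) = γ.deg}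

/-- The usual (étale) topology of `Γ(X, σ)`, with the sets `basicSet σ U k l V`, for `U` and `V`
open in `X`, as a basis. -/
instance [TopologicalSpace X] : TopologicalSpace (Gamma σ) :=
  .generateFrom {W | ∃ (U V : Set X) (k l : ℕ), IsOpen U ∧ IsOpen V ∧ W = basicSet σ U k l V}

theorem continuous_shift [TopologicalSpace X] (hσ : Continuous σ) :
    Continuous (shift σ) := by
  refine continuous_generateFrom_iff.2 ?_
  rintro _ ⟨U, V, k, l, hU, hV, rfl⟩
  by_cases hkl : (k : ℤ) - (l : ℤ) = 1
  · have hk : k = l + 1 := by omega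
    have : shift σ ⁻¹' basicSet σ U k l V = U ∩ σ ⁻¹' V := by
      ext x
      subst hk
      simp [basicSet, Function.iterate_succ_apply]
    rw [this]
    exact hU.inter (hV.preimage hσ)
  · have : shift σ ⁻¹' basicSet σ U k l V = ∅ := by
      ext x
      simp [basicSet, hkl]
    rw [this]
    exact isOpen_empty

theorem continuous_r [TopologicalSpace X] : Continuous (r : Gamma σ → X) := by
  refine continuous_def.2 fun U hU => ?_
  have : r ⁻¹' U = ⋃ (k : ℕ) (l : ℕ), basicSet σ U k l Set.univ := by
    ext γ
    simp only [Set.mem_preimage, basicSet, Set.mem_iUnion, Set.mem_ofPred_eq, Set.mem_univ,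
      true_and]
    constructor
    · intro h
      obtain ⟨k, l, h1, h2⟩ := γ.isArrow
      exact ⟨k, l, h, h1, h2⟩
    · rintro ⟨k, l, h, -⟩
      exact h
  rw [this]
  exact isOpen_iUnion fun k => isOpen_iUnion fun l =>
    isOpen_generateFrom_of_mem ⟨U, Set.univ, k, l, hU, isOpen_univ, rfl⟩

end Gamma

/-- Sheaves of abelian groups on `X`. -/
abbrev AbSheaf (X : Type u) [TopologicalSpace X] := TopCat.Sheaf AddCommGrpCat.{u} (TopCat.of X)

namespace AbSheaf

variable {X : Type u} [TopologicalSpace X]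

/-- The fibre over `x` of the étale space of a sheaf, that is, the stalk at `x`. -/
noncomputable abbrev stalk (F : AbSheaf X) (x : X) : AddCommGrpCat.{u} :=
  TopCat.Presheaf.stalk F.presheaf x

/-- The étale space of a sheaf. -/
abbrev Etale (F : AbSheaf X) : Type u := TopCat.Presheaf.EtaleSpace F.presheaf

/-- The point `a` in the fibre over `x` of the étale space. -/
abbrev pt (F : AbSheaf X) {x : X} (a : F.stalk x) : F.Etale := ⟨x, a⟩

/-- The map on the stalks at `x` induced by a morphism of sheaves. -/
noncomputable abbrev stalkMap {F G : AbSheaf X} (f : F ⟶ G) (x : X) : F.stalk x ⟶ G.stalk x :=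
  (TopCat.Presheaf.stalkFunctor AddCommGrpCat.{u} (X := TopCat.of X) x).map f.hom

theorem continuous_pt_iff {T : Type*} [TopologicalSpace T] (F : AbSheaf X) {r : T → X}
    (hr : Continuous r) (f : ∀ t, F.stalk (r t)) :
    (Continuous fun t => F.pt (f t)) ↔
      ∀ t₀, ∃ (U : Opens (TopCat.of X)) (a : F.presheaf.obj (op U)), r t₀ ∈ U ∧
        ∀ᶠ t in 𝓝 t₀, ∃ h : r t ∈ U, f t = F.presheaf.germ U (r t) h a := by
  constructor
  · intro h t₀
    obtain ⟨U, hU, a, ha⟩ := TopCat.Presheaf.EtaleSpace.exists_section_of_tendsto (h.tendsto t₀)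
    exact ⟨U, a, hU, ha⟩
  · intro h
    rw [continuous_iff_continuousAt]
    intro t₀
    obtain ⟨U, a, hU, ha⟩ := h t₀
    obtain ⟨h₀, ha₀⟩ := ha.self_of_nhds
    rw [ContinuousAt, TopologicalSpace.tendsto_nhds_generateFrom_iff]
    rintro _ ⟨V, b, rfl⟩ ⟨hV, hb⟩
    change f t₀ = _ at hb
    rw [ha₀] at hb
    obtain ⟨W, hW, iU, iV, hab⟩ := F.presheaf.germ_eq _ _ _ _ _ hb
    have hWt : ∀ᶠ t in 𝓝 t₀, r t ∈ W := hr.tendsto t₀ (W.isOpen.mem_nhds hW)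
    filter_upwards [ha, hWt] with t ⟨htU, ht⟩ htW
    refine ⟨iV.le htW, ?_⟩
    change f t = _
    rw [ht, ← F.presheaf.germ_res_apply iU _ htW, hab, F.presheaf.germ_res_apply]

theorem continuous_zero {T : Type*} [TopologicalSpace T] (F : AbSheaf X) {r : T → X}
    (hr : Continuous r) : Continuous fun t => F.pt (0 : F.stalk (r t)) := by
  rw [continuous_pt_iff F hr]
  exact fun t₀ => ⟨⊤, 0, trivial, .of_forall fun t => ⟨trivial, (map_zero _).symm⟩⟩

theorem continuous_neg {T : Type*} [TopologicalSpace T] (F : AbSheaf X) {r : T → X}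
    (hr : Continuous r) {f : ∀ t, F.stalk (r t)} (hf : Continuous fun t => F.pt (f t)) :
    Continuous fun t => F.pt (-f t) := by
  rw [continuous_pt_iff F hr] at hf ⊢
  intro t₀
  obtain ⟨U, a, hU, ha⟩ := hf t₀
  refine ⟨U, -a, hU, ha.mono ?_⟩
  rintro t ⟨h, ht⟩
  exact ⟨h, by rw [ht, map_neg]⟩

theorem continuous_add {T : Type*} [TopologicalSpace T] (F : AbSheaf X) {r : T → X}
    (hr : Continuous r) {f g : ∀ t, F.stalk (r t)} (hf : Continuous fun t => F.pt (f t))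
    (hg : Continuous fun t => F.pt (g t)) : Continuous fun t => F.pt (f t + g t) := by
  rw [continuous_pt_iff F hr] at hf hg ⊢
  intro t₀
  obtain ⟨U, a, hU, ha⟩ := hf t₀
  obtain ⟨V, b, hV, hb⟩ := hg t₀
  refine ⟨U ⊓ V, F.presheaf.map (homOfLE inf_le_left).op a + F.presheaf.map (homOfLE inf_le_right).op b,
    ⟨hU, hV⟩, ?_⟩
  filter_upwards [ha, hb] with t ⟨htU, hta⟩ ⟨htV, htb⟩
  have ht : r t ∈ U ⊓ V := ⟨htU, htV⟩
  refine ⟨ht, ?_⟩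
  rw [map_add, hta, htb]
  exact congrArg₂ (· + ·) (F.presheaf.germ_res_apply _ (r t) ht a).symm
    (F.presheaf.germ_res_apply _ (r t) ht b).symm

theorem continuous_stalkMap {T : Type*} [TopologicalSpace T] {F G : AbSheaf X} (φ : F ⟶ G)
    {r : T → X} (hr : Continuous r) {f : ∀ t, F.stalk (r t)}
    (hf : Continuous fun t => F.pt (f t)) :
    Continuous fun t => G.pt (stalkMap φ (r t) (f t)) := by
  rw [continuous_pt_iff _ hr] at hf ⊢
  intro t₀
  obtain ⟨U, a, hU, ha⟩ := hf t₀
  refine ⟨U, φ.hom.app (op U) a, hU, ha.mono ?_⟩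
  rintro t ⟨h, ht⟩
  exact ⟨h, by rw [ht]; exact TopCat.Presheaf.stalkFunctor_map_germ_apply U (r t) h φ.hom a⟩

/-- Every continuous section of the étale space comes from a unique global section of the
sheaf. -/
theorem existsUnique_section (F : AbSheaf X) (f : ∀ x : X, F.stalk x)
    (hf : Continuous fun x => F.pt (f x)) :
    ∃! a : F.presheaf.obj (op ⊤), ∀ x : X, F.presheaf.germ ⊤ x trivial a = f x := by
  have h := (continuous_pt_iff F continuous_id f).1 hf
  have h' : ∀ x₀ : X, ∃ (U : Opens (TopCat.of X)) (a : F.presheaf.obj (op U)), x₀ ∈ U ∧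
      ∀ x (hx : x ∈ U), f x = F.presheaf.germ U x hx a := by
    intro x₀
    obtain ⟨U, a, hU, ha⟩ := h x₀
    obtain ⟨V, hV, hVo, hxV⟩ := eventually_nhds_iff.1 ha
    refine ⟨⟨V, hVo⟩, F.presheaf.map (homOfLE fun x hx => (hV x hx).1).op a, hxV, fun x hx => ?_⟩
    rw [F.presheaf.germ_res_apply]
    exact (hV x hx).2
  choose U a hU ha using h'
  have hc : TopCat.Presheaf.IsCompatible F.presheaf U a := by
    intro i j
    refine TopCat.Presheaf.section_ext F _ _ _ fun x hx => ?_
    rw [F.presheaf.germ_res_apply, F.presheaf.germ_res_apply, ← ha i x hx.1, ← ha j x hx.2]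
  obtain ⟨b, hb, -⟩ := F.existsUnique_gluing' U ⊤ (fun i => homOfLE le_top)
    (fun x _ => Opens.mem_iSup.2 ⟨x, hU x⟩) a hc
  refine ⟨b, fun x => ?_, fun c hc => ?_⟩
  · rw [ha x x (hU x), ← hb x, F.presheaf.germ_res_apply]
  · refine TopCat.Presheaf.section_ext F _ _ _ fun x hx => ?_
    refine (hc x).trans ?_
    rw [ha x x (hU x), ← hb x, F.presheaf.germ_res_apply]

/-- The functor `S` of global sections, from sheaves of abelian groups over `X` to abelian
groups. -/
noncomputable def globalSections (X : Type u) [TopologicalSpace X] : AbSheaf X ⥤ AddCommGrpCat.{u} :=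
  TopCat.Sheaf.forget AddCommGrpCat.{u} (TopCat.of X) ⋙ (evaluation _ _).obj (op ⊤)

instance : (globalSections X).Additive where

end AbSheaf

open AbSheaf

/-- The fibre product `Γ ×_X E` of pairs `(γ, e)`, with `e` in the étale space `E` of `F` over the
source of `γ`. -/
structure ActionDomain {X : Type u} [TopologicalSpace X] (σ : X → X) (F : AbSheaf X) : Type u where
  arrow : Gamma σ
  germ : F.stalk arrow.s

/-- The topology of `Γ ×_X E` as a subspace of `Γ × E`. -/
instance {X : Type u} [TopologicalSpace X] (σ : X → X) (F : AbSheaf X) :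
    TopologicalSpace (ActionDomain σ F) :=
  .induced (fun p => ((p.arrow, F.pt p.germ) : Gamma σ × F.Etale)) inferInstance

/-- A `Γ`-sheaf: a sheaf of abelian groups over the unit space `X` of `Γ = Γ(X, σ)` with a
continuous action of `Γ` on its étale space, where `γ` acts by a homomorphism from the fibre over
`s γ` to the fibre over `r γ`. -/
structure GammaSheaf {X : Type u} [TopologicalSpace X] (σ : X → X) : Type (u + 1) where
  sheaf : AbSheaf X
  act : ∀ γ : Gamma σ, sheaf.stalk γ.s ⟶ sheaf.stalk γ.r
  act_unit : ∀ x : X, act (Gamma.unit σ x) = 𝟙 (sheaf.stalk x)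
  act_mul : ∀ {x y z : X} {m n : ℤ} (h : IsArrow σ x m y) (h' : IsArrow σ y n z)
    (a : sheaf.stalk z), act (Gamma.mul h h') a = act ⟨x, m, y, h⟩ (act ⟨y, n, z, h'⟩ a)
  continuous_act : Continuous fun p : ActionDomain σ sheaf => sheaf.pt (act p.arrow p.germ)

noncomputable section

namespace GammaSheaf

variable {X : Type u} [TopologicalSpace X] {σ : X → X}

/-- A morphism of `Γ`-sheaves: an equivariant morphism of sheaves. -/
@[ext]
structure Hom (A B : GammaSheaf σ) : Type u where
  hom : A.sheaf ⟶ B.sheaf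
  equivariant : ∀ (γ : Gamma σ) (a : A.sheaf.stalk γ.s),
    stalkMap hom γ.r (A.act γ a) = B.act γ (stalkMap hom γ.s a)

theorem stalkMap_id (F : AbSheaf X) (x : X) : stalkMap (𝟙 F) x = 𝟙 _ :=
  (TopCat.Presheaf.stalkFunctor AddCommGrpCat.{u} (X := TopCat.of X) x).map_id F.obj

theorem stalkMap_comp {F G H : AbSheaf X} (f : F ⟶ G) (g : G ⟶ H) (x : X) :
    stalkMap (f ≫ g) x = stalkMap f x ≫ stalkMap g x :=
  (TopCat.Presheaf.stalkFunctor AddCommGrpCat.{u} (X := TopCat.of X) x).map_comp f.hom g.hom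

theorem stalkMap_add {F G : AbSheaf X} (f g : F ⟶ G) (x : X) :
    stalkMap (f + g) x = stalkMap f x + stalkMap g x :=
  (TopCat.Presheaf.stalkFunctor AddCommGrpCat.{u} (X := TopCat.of X) x).map_add
    (f := f.hom) (g := g.hom)

theorem stalkMap_zero {F G : AbSheaf X} (x : X) :
    stalkMap (0 : F ⟶ G) x = 0 :=
  (TopCat.Presheaf.stalkFunctor AddCommGrpCat.{u} (X := TopCat.of X) x).map_zero F.obj G.obj

theorem stalkMap_neg {F G : AbSheaf X} (f : F ⟶ G) (x : X) :
    stalkMap (-f) x = -stalkMap f x :=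
  (TopCat.Presheaf.stalkFunctor AddCommGrpCat.{u} (X := TopCat.of X) x).map_neg (f := f.hom)

/-- The category `Ab(Γ)` of `Γ`-sheaves. -/
instance : Category (GammaSheaf σ) where
  Hom := Hom
  id A := ⟨𝟙 _, fun γ a => by simp [stalkMap_id]⟩
  comp f g := ⟨f.hom ≫ g.hom, fun γ a => by
    simp [stalkMap_comp, f.equivariant, g.equivariant]⟩

@[ext]
theorem hom_ext {A B : GammaSheaf σ} {f g : A ⟶ B} (h : f.hom = g.hom) : f = g :=
  Hom.ext h

@[simp]
theorem id_hom (A : GammaSheaf σ) : Hom.hom (𝟙 A) = 𝟙 A.sheaf := rfl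

@[simp]
theorem comp_hom {A B C : GammaSheaf σ} (f : A ⟶ B) (g : B ⟶ C) :
    (f ≫ g).hom = f.hom ≫ g.hom := rfl

/-- The subgroup of equivariant morphisms. -/
def equivariantSubgroup (A B : GammaSheaf σ) : AddSubgroup (A.sheaf ⟶ B.sheaf) where
  carrier := {f | ∀ (γ : Gamma σ) (a : A.sheaf.stalk γ.s),
    stalkMap f γ.r (A.act γ a) = B.act γ (stalkMap f γ.s a)}
  add_mem' {f g} hf hg γ a := by
    simp [stalkMap_add, hf γ a, hg γ a]
  zero_mem' γ a := by
    simp [stalkMap_zero]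
  neg_mem' {f} hf γ a := by
    simp [stalkMap_neg, hf γ a]

/-- Morphisms of `Γ`-sheaves as a subgroup of the morphisms of sheaves. -/
def homEquiv (A B : GammaSheaf σ) : (A ⟶ B) ≃ equivariantSubgroup A B where
  toFun f := ⟨f.hom, f.equivariant⟩
  invFun f := ⟨f.1, f.2⟩

/-- Morphisms of `Γ`-sheaves are added as morphisms of sheaves. -/
instance (A B : GammaSheaf σ) : AddCommGroup (A ⟶ B) := (homEquiv A B).addCommGroup

@[simp]
theorem add_hom {A B : GammaSheaf σ} (f g : A ⟶ B) : (f + g).hom = f.hom + g.hom := rfl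

instance : Preadditive (GammaSheaf σ) where
  add_comp A B C f g h := by ext1; simp
  comp_add A B C f g h := by ext1; simp

/-- The functor from `Γ`-sheaves to sheaves of abelian groups over `X` forgetting the action. -/
@[simps]
def forgetAction (σ : X → X) : GammaSheaf σ ⥤ AbSheaf X where
  obj A := A.sheaf
  map f := f.hom

instance : (forgetAction σ).Additive where

end GammaSheaf

namespace GammaSheaf

variable {X : Type u} [TopologicalSpace X] {σ : X → X}

/-- The group `Z_Γ(A)` of continuous one-cocycles, that is, of continuous maps `f` from `Γ` to the
étale space of `A` with `f γ` in the fibre over `r γ` and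
`f (γ₁ γ₂) = f γ₁ + γ₁ f γ₂` for composable `γ₁`, `γ₂`. -/
def cocycles (A : GammaSheaf σ) : AddSubgroup (∀ γ : Gamma σ, A.sheaf.stalk γ.r) where
  carrier := {f | (Continuous fun γ => A.sheaf.pt (f γ)) ∧
    ∀ {x y z : X} {m n : ℤ} (h : IsArrow σ x m y) (h' : IsArrow σ y n z),
      f (Gamma.mul h h') = f ⟨x, m, y, h⟩ + A.act ⟨x, m, y, h⟩ (f ⟨y, n, z, h'⟩)}
  add_mem' {f g} hf hg := by
    refine ⟨continuous_add _ Gamma.continuous_r hf.1 hg.1, fun h h' => ?_⟩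
    simp only [Pi.add_apply, hf.2 h h', hg.2 h h', map_add]
    exact add_add_add_comm _ _ _ _
  zero_mem' := by
    refine ⟨continuous_zero _ Gamma.continuous_r, fun h h' => ?_⟩
    simp only [Pi.zero_apply, map_zero]
    exact (add_zero _).symm
  neg_mem' {f} hf := by
    refine ⟨continuous_neg _ Gamma.continuous_r hf.1, fun h h' => ?_⟩
    simp only [Pi.neg_apply, hf.2 h h', map_neg]
    exact neg_add _ _

/-- The map `Z_Γ(A) → Z_Γ(B)` induced by a morphism `A → B`. -/
def cocyclesMap {A B : GammaSheaf σ} (φ : A ⟶ B) : cocycles A →+ cocycles B where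
  toFun f := ⟨fun γ => stalkMap φ.hom γ.r (f.1 γ),
    continuous_stalkMap φ.hom Gamma.continuous_r f.2.1, fun {x y z m n} h h' => by
      have := φ.equivariant ⟨x, m, y, h⟩ (f.1 ⟨y, n, z, h'⟩)
      change stalkMap φ.hom x (f.1 (Gamma.mul h h')) = stalkMap φ.hom x (f.1 ⟨x, m, y, h⟩) +
        B.act ⟨x, m, y, h⟩ (stalkMap φ.hom y (f.1 ⟨y, n, z, h'⟩))
      rw [f.2.2 h h', ← this]
      exact map_add (stalkMap φ.hom x).hom _ _⟩
  map_zero' := by ext γ; simp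
  map_add' f g := by ext γ; simp

/-- The cocycle functor `Z_Γ : Ab(Γ) ⥤ Ab`. -/
def cocycleFunctor (σ : X → X) : GammaSheaf σ ⥤ AddCommGrpCat.{u} where
  obj A := AddCommGrpCat.of (cocycles A)
  map φ := AddCommGrpCat.ofHom (cocyclesMap φ)
  map_id A := by
    refine AddCommGrpCat.hom_ext (AddMonoidHom.ext fun f => Subtype.ext (funext fun γ => ?_))
    change stalkMap (𝟙 A.sheaf) γ.r (f.1 γ) = f.1 γ
    rw [stalkMap_id]
    rfl
  map_comp {A B C} φ ψ := by
    refine AddCommGrpCat.hom_ext (AddMonoidHom.ext fun f => Subtype.ext (funext fun γ => ?_))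
    change stalkMap (φ.hom ≫ ψ.hom) γ.r (f.1 γ) = stalkMap ψ.hom γ.r (stalkMap φ.hom γ.r (f.1 γ))
    rw [stalkMap_comp]
    rfl

instance : (cocycleFunctor σ).Additive where
  map_add {A B φ ψ} := by
    refine AddCommGrpCat.hom_ext (AddMonoidHom.ext fun f => Subtype.ext (funext fun γ => ?_))
    change stalkMap (φ.hom + ψ.hom) γ.r (f.1 γ) =
      stalkMap φ.hom γ.r (f.1 γ) + stalkMap ψ.hom γ.r (f.1 γ)
    rw [stalkMap_add]
    rfl

theorem existsUnique_evalShift (hσ : Continuous σ) (A : GammaSheaf σ) (f : cocycles A) :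
    ∃! a : A.sheaf.presheaf.obj (op ⊤), ∀ x : X,
      A.sheaf.presheaf.germ ⊤ x trivial a = f.1 (Gamma.shift σ x) :=
  existsUnique_section A.sheaf (fun x => f.1 (Gamma.shift σ x))
    (f.2.1.comp (Gamma.continuous_shift hσ))

/-- The global section `φ_A(f)` of `A`, for a cocycle `f`: as a continuous section of the étale
space it is `x ↦ f (x, 1, σ x)`. -/
def evalShiftFun (hσ : Continuous σ) (A : GammaSheaf σ) (f : cocycles A) :
    A.sheaf.presheaf.obj (op ⊤) :=
  (existsUnique_evalShift hσ A f).choose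

theorem germ_evalShiftFun (hσ : Continuous σ) (A : GammaSheaf σ) (f : cocycles A) (x : X) :
    A.sheaf.presheaf.germ ⊤ x trivial (evalShiftFun hσ A f) = f.1 (Gamma.shift σ x) :=
  (existsUnique_evalShift hσ A f).choose_spec.1 x

theorem evalShiftFun_eq (hσ : Continuous σ) (A : GammaSheaf σ) (f : cocycles A)
    (a : A.sheaf.presheaf.obj (op ⊤))
    (ha : ∀ x : X, A.sheaf.presheaf.germ ⊤ x trivial a = f.1 (Gamma.shift σ x)) :
    evalShiftFun hσ A f = a :=
  (existsUnique_evalShift hσ A f).unique (germ_evalShiftFun hσ A f) ha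

/-- The homomorphism `φ_A : Z_Γ(A) → S(A)`. -/
def evalShiftHom (hσ : Continuous σ) (A : GammaSheaf σ) :
    cocycles A →+ A.sheaf.presheaf.obj (op ⊤) where
  toFun := evalShiftFun hσ A
  map_zero' := evalShiftFun_eq hσ A _ _ fun x => by simp
  map_add' f g := evalShiftFun_eq hσ A _ _ fun x => by
    rw [map_add, germ_evalShiftFun, germ_evalShiftFun]
    rfl

/-- The natural transformation `φ : Z_Γ ⟶ S`, with `φ_A(f)(x) = f (x, 1, σ x)`. -/
def evalShift (hσ : Continuous σ) :
    cocycleFunctor σ ⟶ forgetAction σ ⋙ globalSections X where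
  app A := AddCommGrpCat.ofHom (evalShiftHom hσ A)
  naturality A B φ := by
    ext f
    refine evalShiftFun_eq hσ B _ _ fun x => ?_
    change _ = stalkMap φ.hom x (f.1 (Gamma.shift σ x))
    rw [← germ_evalShiftFun hσ A f x]
    exact (TopCat.Presheaf.stalkFunctor_map_germ_apply ⊤ x trivial φ.hom.hom _).symm

end GammaSheaf

/-- A preadditive category is abelian (this is a property of the category). -/
structure IsAbelianCategory (C : Type*) [Category* C] [Preadditive C] : Prop where
  hasFiniteProducts : Limits.HasFiniteProducts C
  hasKernels : Limits.HasKernels C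
  hasCokernels : Limits.HasCokernels C
  isNormalMonoCategory : IsNormalMonoCategory C
  isNormalEpiCategory : IsNormalEpiCategory C

/-- The structure of an abelian category on an abelian preadditive category. -/
@[reducible]
def IsAbelianCategory.abelian {C : Type*} [Category* C] [P : Preadditive C]
    (h : IsAbelianCategory C) : Abelian C where
  toPreadditive := P
  toIsNormalMonoCategory := h.isNormalMonoCategory
  toIsNormalEpiCategory := h.isNormalEpiCategory
  has_finite_products := h.hasFiniteProducts
  has_kernels := h.hasKernels
  has_cokernels := h.hasCokernels

end

end LocalHomeoGroupoid

open LocalHomeoGroupoid GammaSheaf AbSheaf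

open LocalHomeoGroupoid GammaSheaf AbSheaf

/-! Write `U` for the forgetful functor `forgetAction σ`. Three facts give the theorem: `φ` is an
isomorphism of functors from `Z_Γ` to `S ∘ U`, the functor `U` is exact, and `U` preserves injective
objects. Then `U` takes an injective resolution `I` of `A` to an injective resolution of the
underlying sheaf, and `Z_Γ(I) ≅ S(U I)` computes both derived functors.

The first fact is `bijective_evalShiftHom`. Every arrow is a quotient of arrows `(x, k, σ^k x)`,
which are products of arrows `(x, 1, σ x)`. A cocycle is therefore determined by its values at the
latter, and any global section `g` prescribes such values: `(x, k - l, y)` receives the `k`-fold sum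
of `g` along the orbit of `x` minus the transported `l`-fold sum along the orbit of `y`.

Exactness holds because kernels and cokernels of equivariant maps, formed in sheaves, inherit the
action. The same construction makes `Ab(Γ)` abelian (`isAbelianCategory`).

Injectives come from an equivariant Godement construction. For groups `D x`, a section of `godement
σ D` over an open set is an arbitrary family of elements of `D (s γ)`, over all arrows `γ` with
range in that set. Maps to it amount to homomorphisms from stalks `F_x` to `D z` for all arrows from
`z` to `x`. Since `Γ` is étale, an arrow extends to a local section of `r`, and translation along
this section defines an action; equivariant maps then amount to homomorphisms `B_x → D x`. If all `D
x` are injective, the Godement object is injective both in `Ab(Γ)` and in `Ab(X)`. Every `Γ`-sheaf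
embeds in such an object, and an injective one is a retract of it, so its underlying sheaf is
injective (`preservesInjectiveObjects_forgetAction`). -/

namespace LocalHomeoGroupoid

/-! ### Stalks of sheaves and continuity of actions. -/

namespace Gamma

variable {X : Type u} {σ : X → X}

theorem continuous_s [TopologicalSpace X] : Continuous (s : Gamma σ → X) := by
  refine continuous_def.2 fun U hU => ?_
  have : s ⁻¹' U = ⋃ (k : ℕ) (l : ℕ), basicSet σ Set.univ k l U := by
    ext γ
    simp only [Set.mem_preimage, basicSet, Set.mem_iUnion, Set.mem_ofPred_eq, Set.mem_univ,
      true_and]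
    constructor
    · intro h
      obtain ⟨k, l, h1, h2⟩ := γ.isArrow
      exact ⟨k, l, h, h1, h2⟩
    · rintro ⟨k, l, h, -⟩
      exact h
  rw [this]
  exact isOpen_iUnion fun k => isOpen_iUnion fun l =>
    isOpen_generateFrom_of_mem ⟨Set.univ, U, k, l, isOpen_univ, hU, rfl⟩

end Gamma

namespace AbSheaf

variable {X : Type u} [TopologicalSpace X]

theorem stalkMap_germ {F G : AbSheaf X} (f : F ⟶ G) {U : Opens (TopCat.of X)} {x : X} (hx : x ∈ U)
    (a : F.presheaf.obj (op U)) :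
    stalkMap f x (F.presheaf.germ U x hx a) = G.presheaf.germ U x hx (f.hom.app (op U) a) :=
  TopCat.Presheaf.stalkFunctor_map_germ_apply U x hx f.hom a

theorem exists_germ (F : AbSheaf X) {x : X} (a : F.stalk x) :
    ∃ (U : Opens (TopCat.of X)) (h : x ∈ U) (b : F.presheaf.obj (op U)),
      F.presheaf.germ U x h b = a :=
  F.presheaf.exists_germ_eq a

theorem eventually_germ_eq (F : AbSheaf X) {U V : Opens (TopCat.of X)} {x : X} (hU : x ∈ U)
    (hV : x ∈ V) {a : F.presheaf.obj (op U)} {b : F.presheaf.obj (op V)}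
    (h : F.presheaf.germ U x hU a = F.presheaf.germ V x hV b) :
    ∀ᶠ y in 𝓝 x, ∃ (hU : y ∈ U) (hV : y ∈ V),
      F.presheaf.germ U y hU a = F.presheaf.germ V y hV b := by
  obtain ⟨W, hW, iU, iV, hab⟩ := F.presheaf.germ_eq _ _ _ _ _ h
  filter_upwards [W.isOpen.mem_nhds hW] with y hy
  refine ⟨iU.le hy, iV.le hy, ?_⟩
  rw [← F.presheaf.germ_res_apply iU _ hy, hab, F.presheaf.germ_res_apply]

theorem stalkMap_injective {F G : AbSheaf X} (f : F ⟶ G) [Mono f] (x : X) :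
    Function.Injective (stalkMap f x) :=
  (AddCommGrpCat.mono_iff_injective _).1
    (TopCat.Presheaf.stalk_mono_of_mono (X := TopCat.of X) f x)

theorem stalkMap_surjective {F G : AbSheaf X} (f : F ⟶ G) [Epi f] (x : X) :
    Function.Surjective (stalkMap f x) :=
  (AddCommGrpCat.epi_iff_surjective _).1
    ((TopCat.Sheaf.forget AddCommGrpCat (TopCat.of X) ⋙
      TopCat.Presheaf.stalkFunctor AddCommGrpCat.{u} (X := TopCat.of X) x).map_epi f)

theorem exists_stalkMap_eq_of_exact {S : ShortComplex (AbSheaf X)} (hS : S.Exact) {x : X}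
    (b : S.X₂.stalk x) (hb : stalkMap S.g x b = 0) : ∃ a, stalkMap S.f x a = b :=
  (ShortComplex.ab_exact_iff _).1
    ((TopCat.Sheaf.exact_iff_stalkFunctor_map_exact (X := TopCat.of X) S).1 hS x) b hb

end AbSheaf

noncomputable section

namespace GammaSheaf

variable {X : Type u} [TopologicalSpace X] {σ : X → X}

/-- A family of maps between the stalks of a sheaf, indexed by the arrows of `Γ`, is continuous if
and only if it locally takes sections to sections. -/
theorem continuous_act_iff (F : AbSheaf X) (act : ∀ γ : Gamma σ, F.stalk γ.s ⟶ F.stalk γ.r) :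
    (Continuous fun p : ActionDomain σ F => F.pt (act p.arrow p.germ)) ↔
      ∀ (γ₀ : Gamma σ) (U : Opens (TopCat.of X)) (a : F.presheaf.obj (op U)), γ₀.s ∈ U →
        ∃ (V : Opens (TopCat.of X)) (b : F.presheaf.obj (op V)), γ₀.r ∈ V ∧
          ∀ᶠ γ in 𝓝 γ₀, ∃ (hs : γ.s ∈ U) (hr : γ.r ∈ V),
            act γ (F.presheaf.germ U γ.s hs a) = F.presheaf.germ V γ.r hr b := by
  have hp : Continuous fun p : ActionDomain σ F => (p.arrow, F.pt p.germ) :=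
    continuous_induced_dom
  have harrow : Continuous (ActionDomain.arrow : ActionDomain σ F → Gamma σ) :=
    continuous_fst.comp hp
  have hgerm : Continuous (fun p : ActionDomain σ F => F.pt p.germ) :=
    continuous_snd.comp hp
  constructor
  · intro h γ₀ U a hU
    -- Only arrows with source in `U` have a germ of `a` to act on, so continuity is tested on this
    -- open subspace of `Γ`.
    let T := {γ : Gamma σ // γ.s ∈ U}
    have hT : IsOpen {γ : Gamma σ | γ.s ∈ U} := U.isOpen.preimage Gamma.continuous_s
    let j : T → ActionDomain σ F := fun γ => ⟨γ.1, F.presheaf.germ U γ.1.s γ.2 a⟩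
    have hj : Continuous j := by
      refine continuous_induced_rng.2 (continuous_subtype_val.prodMk ?_)
      refine (continuous_pt_iff F (r := fun t : T => t.1.s)
        (Gamma.continuous_s.comp continuous_subtype_val) _).2 fun t₀ => ?_
      exact ⟨U, a, t₀.2, .of_forall fun t => ⟨t.2, rfl⟩⟩
    obtain ⟨V, b, hV, hb⟩ := (continuous_pt_iff F (r := fun t : T => t.1.r)
      (Gamma.continuous_r.comp continuous_subtype_val)
      (fun t => act t.1 (F.presheaf.germ U t.1.s t.2 a))).1 (h.comp hj) ⟨γ₀, hU⟩
    refine ⟨V, b, hV, ?_⟩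
    rw [nhds_subtype_eq_comap, Filter.eventually_comap] at hb
    filter_upwards [hb, hT.mem_nhds hU] with γ h1 h2
    obtain ⟨hr, h3⟩ := h1 ⟨γ, h2⟩ rfl
    exact ⟨h2, hr, h3⟩
  · intro h
    refine (continuous_pt_iff F (r := fun p : ActionDomain σ F => p.arrow.r)
      (Gamma.continuous_r.comp harrow) _).2 fun p₀ => ?_
    obtain ⟨U, a, hU, ha⟩ := (continuous_pt_iff F (r := fun p : ActionDomain σ F => p.arrow.s)
      (Gamma.continuous_s.comp harrow) _).1 hgerm p₀
    obtain ⟨V, b, hV, hb⟩ := h p₀.arrow U a hU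
    refine ⟨V, b, hV, ?_⟩
    filter_upwards [ha, harrow.continuousAt.eventually hb] with p ⟨_, h1⟩ ⟨_, hr, h2⟩
    exact ⟨hr, by rw [h1, h2]⟩

theorem continuous_act_comp (A : GammaSheaf σ) {T : Type*} [TopologicalSpace T] {g : T → Gamma σ}
    (hg : Continuous g) {f : ∀ t, A.sheaf.stalk (g t).s}
    (hf : Continuous fun t => A.sheaf.pt (f t)) :
    Continuous fun t => A.sheaf.pt (A.act (g t) (f t)) :=
  A.continuous_act.comp (f := fun t => (⟨g t, f t⟩ : ActionDomain σ A.sheaf))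
    (continuous_induced_rng.2 (hg.prodMk hf))

/-! ### Invariant subsheaves and quotients. -/

section Sub

variable (A : GammaSheaf σ) {K : AbSheaf X} (ι : K ⟶ A.sheaf) [Mono ι]
  (h : ∀ (γ : Gamma σ) (a : K.stalk γ.s), ∃ b, stalkMap ι γ.r b = A.act γ (stalkMap ι γ.s a))

/-- The action on an invariant subsheaf. -/
def subAct (γ : Gamma σ) : K.stalk γ.s ⟶ K.stalk γ.r :=
  AddCommGrpCat.ofHom (X := K.stalk γ.s) (Y := K.stalk γ.r) <|
    show K.stalk γ.s →+ K.stalk γ.r from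
    { toFun := fun a => (h γ a).choose
      map_zero' := stalkMap_injective ι _ (by rw [(h γ 0).choose_spec]; simp)
      map_add' := fun a b => stalkMap_injective ι _ (by
        rw [(h γ (a + b)).choose_spec, map_add, map_add, map_add, (h γ a).choose_spec,
          (h γ b).choose_spec]) }

theorem stalkMap_subAct (γ : Gamma σ) (a : K.stalk γ.s) :
    stalkMap ι γ.r (subAct A ι h γ a) = A.act γ (stalkMap ι γ.s a) :=
  (h γ a).choose_spec

/-- An invariant subsheaf of a `Γ`-sheaf as a `Γ`-sheaf. -/
def sub : GammaSheaf σ where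
  sheaf := K
  act := subAct A ι h
  act_unit x := by
    ext a
    refine stalkMap_injective ι x ?_
    refine (stalkMap_subAct A ι h (Gamma.unit σ x) a).trans ?_
    rw [A.act_unit]
    rfl
  act_mul {x y z m n} h₁ h₂ a := by
    refine stalkMap_injective ι x ?_
    refine (stalkMap_subAct A ι h (Gamma.mul h₁ h₂) a).trans ?_
    refine Eq.trans ?_ (stalkMap_subAct A ι h ⟨x, m, y, h₁⟩ _).symm
    refine (A.act_mul h₁ h₂ _).trans ?_
    exact congrArg _ (stalkMap_subAct A ι h ⟨y, n, z, h₂⟩ a).symm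
  continuous_act := by
    rw [continuous_act_iff]
    intro γ₀ U a hU
    obtain ⟨V, b, hV, hb⟩ := (continuous_act_iff A.sheaf A.act).1 A.continuous_act γ₀ U
      (ι.hom.app (op U) a) hU
    -- The local section `b` of `A` need not lie in `K`. Its germ at `γ₀.r` does, so `b` agrees near
    -- that point with the image of a section `k` of `K`.
    obtain ⟨W, hW, k, hk⟩ := exists_germ K (subAct A ι h γ₀ (K.presheaf.germ U γ₀.s hU a))
    refine ⟨W, k, hW, ?_⟩
    have h₀ : A.sheaf.presheaf.germ V γ₀.r hV b =
        A.sheaf.presheaf.germ W γ₀.r hW (ι.hom.app (op W) k) := by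
      obtain ⟨_, _, h1⟩ := hb.self_of_nhds
      rw [← h1, ← stalkMap_germ ι, ← stalkMap_germ ι, hk, stalkMap_subAct]
    filter_upwards [hb, Gamma.continuous_r.continuousAt.eventually
      (eventually_germ_eq A.sheaf hV hW h₀)] with γ ⟨hs, _, h1⟩ ⟨_, hr, h2⟩
    refine ⟨hs, hr, stalkMap_injective ι _ ?_⟩
    rw [stalkMap_subAct, stalkMap_germ, stalkMap_germ, h1, h2]

/-- The inclusion of an invariant subsheaf. -/
def subι : sub A ι h ⟶ A := ⟨ι, stalkMap_subAct A ι h⟩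

end Sub

section Quot

/-- This makes the quotient action independent of the chosen lifts to the stalks of `B`. -/
theorem stalkMap_act_congr (B : GammaSheaf σ) {C : AbSheaf X} (π : B.sheaf ⟶ C)
    (h : ∀ (γ : Gamma σ) (b : B.sheaf.stalk γ.s), stalkMap π γ.s b = 0 →
      stalkMap π γ.r (B.act γ b) = 0)
    (γ : Gamma σ) {b b' : B.sheaf.stalk γ.s}
    (hb : stalkMap π γ.s b = stalkMap π γ.s b') :
    stalkMap π γ.r (B.act γ b) = stalkMap π γ.r (B.act γ b') := by
  rw [← sub_eq_zero, ← map_sub, ← map_sub]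
  refine h γ _ ?_
  rw [map_sub, hb, sub_self]

variable (B : GammaSheaf σ) {C : AbSheaf X} (π : B.sheaf ⟶ C) [Epi π]
  (h : ∀ (γ : Gamma σ) (b : B.sheaf.stalk γ.s), stalkMap π γ.s b = 0 →
    stalkMap π γ.r (B.act γ b) = 0)

/-- The action on an invariant quotient sheaf. -/
def quotAct (γ : Gamma σ) : C.stalk γ.s ⟶ C.stalk γ.r :=
  AddCommGrpCat.ofHom (X := C.stalk γ.s) (Y := C.stalk γ.r) <|
    show C.stalk γ.s →+ C.stalk γ.r from
    { toFun := fun c => stalkMap π γ.r (B.act γ (stalkMap_surjective π γ.s c).choose)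
      map_zero' := h γ _ (stalkMap_surjective π γ.s 0).choose_spec
      map_add' := fun c d => by
        rw [← map_add, ← map_add]
        refine stalkMap_act_congr B π h γ ?_
        rw [map_add, (stalkMap_surjective π γ.s (c + d)).choose_spec,
          (stalkMap_surjective π γ.s c).choose_spec, (stalkMap_surjective π γ.s d).choose_spec] }

theorem quotAct_stalkMap (γ : Gamma σ) (b : B.sheaf.stalk γ.s) :
    quotAct B π h γ (stalkMap π γ.s b) = stalkMap π γ.r (B.act γ b) :=
  stalkMap_act_congr B π h γ (stalkMap_surjective π γ.s _).choose_spec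

/-- The quotient of a `Γ`-sheaf by an invariant subsheaf as a `Γ`-sheaf. -/
def quot : GammaSheaf σ where
  sheaf := C
  act := quotAct B π h
  act_unit x := by
    ext c
    obtain ⟨b, rfl⟩ := stalkMap_surjective π x c
    refine (quotAct_stalkMap B π h (Gamma.unit σ x) b).trans ?_
    rw [B.act_unit]
    rfl
  act_mul {x y z m n} h₁ h₂ c := by
    obtain ⟨b, rfl⟩ := stalkMap_surjective π z c
    refine (quotAct_stalkMap B π h (Gamma.mul h₁ h₂) b).trans ?_
    refine Eq.trans ?_ (congrArg _ (quotAct_stalkMap B π h ⟨y, n, z, h₂⟩ b).symm)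
    refine Eq.trans ?_ (quotAct_stalkMap B π h ⟨x, m, y, h₁⟩ _).symm
    exact congrArg _ (B.act_mul h₁ h₂ _)
  continuous_act := by
    rw [continuous_act_iff]
    intro γ₀ U c hU
    -- A section of the quotient lifts only locally: a lift of its germ at `γ₀.s` gives a section
    -- `b` whose image agrees with `c` near that point, and there the continuity of the action on
    -- `B` applies.
    obtain ⟨b₀, hb₀⟩ := stalkMap_surjective π γ₀.s (C.presheaf.germ U γ₀.s hU c)
    obtain ⟨V, hV, b, rfl⟩ := exists_germ B.sheaf b₀
    rw [stalkMap_germ] at hb₀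
    obtain ⟨W, d, hW, hd⟩ := (continuous_act_iff B.sheaf B.act).1 B.continuous_act γ₀ V b hV
    refine ⟨W, π.hom.app (op W) d, hW, ?_⟩
    filter_upwards [hd, Gamma.continuous_s.continuousAt.eventually
      (eventually_germ_eq C hV hU hb₀)] with γ ⟨_, hr, h1⟩ ⟨_, hs, h2⟩
    refine ⟨hs, hr, ?_⟩
    rw [← h2, ← stalkMap_germ, ← stalkMap_germ, quotAct_stalkMap, h1]

/-- The projection to a quotient of a `Γ`-sheaf. -/
def quotπ : B ⟶ quot B π h := ⟨π, fun γ b => (quotAct_stalkMap B π h γ b).symm⟩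

end Quot

end GammaSheaf

end

/-! ### The category of `Γ`-sheaves is abelian and the forgetful functor is exact. -/

open CategoryTheory.Limits ZeroObject

noncomputable section

namespace GammaSheaf

variable {X : Type u} [TopologicalSpace X] {σ : X → X}

/-- A morphism of sheaves that becomes equivariant after composition with an equivariant
monomorphism is equivariant. -/
def liftMono {A B C : GammaSheaf σ} (f : A ⟶ B) [Mono f.hom] (g : C ⟶ B) (k : C.sheaf ⟶ A.sheaf)
    (hk : k ≫ f.hom = g.hom) : C ⟶ A where
  hom := k
  equivariant γ a := by
    have h : ∀ x c, stalkMap f.hom x (stalkMap k x c) = stalkMap g.hom x c := fun x c => by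
      rw [← hk, stalkMap_comp]; rfl
    refine stalkMap_injective f.hom _ ?_
    rw [h, f.equivariant, h, g.equivariant]

/-- A morphism of sheaves that becomes equivariant after composition with an equivariant
epimorphism is equivariant. -/
def descEpi {A B C : GammaSheaf σ} (f : A ⟶ B) [Epi f.hom] (g : A ⟶ C) (k : B.sheaf ⟶ C.sheaf)
    (hk : f.hom ≫ k = g.hom) : B ⟶ C where
  hom := k
  equivariant γ b := by
    have h : ∀ x c, stalkMap k x (stalkMap f.hom x c) = stalkMap g.hom x c := fun x c => by
      rw [← hk, stalkMap_comp]; rfl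
    obtain ⟨a, rfl⟩ := stalkMap_surjective f.hom _ b
    rw [← f.equivariant, h, h, g.equivariant]

theorem stalkMap_eq_zero_of_comp_eq_zero {F G H : AbSheaf X} {f : F ⟶ G} {g : G ⟶ H}
    (h : f ≫ g = 0) (x : X) (a : F.stalk x) : stalkMap g x (stalkMap f x a) = 0 := by
  have := stalkMap_comp f g x
  rw [h, stalkMap_zero] at this
  exact (ConcreteCategory.congr_hom this a).symm

instance : (forgetAction σ).Faithful where
  map_injective h := hom_ext h

/-- A fork of `Γ`-sheaves is a kernel if the underlying fork of sheaves is. -/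
def isLimitKernelFork {A B C : GammaSheaf σ} {f : A ⟶ B} {g : B ⟶ C} (w : f ≫ g = 0)
    (w' : f.hom ≫ g.hom = 0) (h : IsLimit (KernelFork.ofι f.hom w')) :
    IsLimit (KernelFork.ofι f w) :=
  haveI : Mono f.hom := mono_of_isLimit_fork h
  haveI : Mono f := (forgetAction σ).mono_of_mono_map (f := f) ‹_›
  KernelFork.IsLimit.ofι' f w fun k hk =>
    have hk' : k.hom ≫ g.hom = 0 := congrArg Hom.hom hk
    ⟨liftMono f k (KernelFork.IsLimit.lift' h k.hom hk').1
      (KernelFork.IsLimit.lift' h k.hom hk').2, hom_ext (KernelFork.IsLimit.lift' h k.hom hk').2⟩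

/-- A cofork of `Γ`-sheaves is a cokernel if the underlying cofork of sheaves is. -/
def isColimitCokernelCofork {A B C : GammaSheaf σ} {f : A ⟶ B} {g : B ⟶ C} (w : f ≫ g = 0)
    (w' : f.hom ≫ g.hom = 0) (h : IsColimit (CokernelCofork.ofπ g.hom w')) :
    IsColimit (CokernelCofork.ofπ g w) :=
  haveI : Epi g.hom := epi_of_isColimit_cofork h
  haveI : Epi g := (forgetAction σ).epi_of_epi_map (f := g) ‹_›
  CokernelCofork.IsColimit.ofπ' g w fun k hk =>
    have hk' : f.hom ≫ k.hom = 0 := congrArg Hom.hom hk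
    ⟨descEpi g k (CokernelCofork.IsColimit.desc' h k.hom hk').1
      (CokernelCofork.IsColimit.desc' h k.hom hk').2,
      hom_ext (CokernelCofork.IsColimit.desc' h k.hom hk').2⟩

section Kernel

variable {A B : GammaSheaf σ} (f : A ⟶ B)

theorem kernel_invariant (γ : Gamma σ) (a : (kernel f.hom).stalk γ.s) :
    ∃ b, stalkMap (kernel.ι f.hom) γ.r b = A.act γ (stalkMap (kernel.ι f.hom) γ.s a) := by
  refine exists_stalkMap_eq_of_exact (ShortComplex.exact_of_f_is_kernel
    (ShortComplex.mk _ _ (kernel.condition f.hom)) (kernelIsKernel f.hom)) _ ?_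
  dsimp only
  rw [f.equivariant, stalkMap_eq_zero_of_comp_eq_zero (kernel.condition f.hom), map_zero]

/-- The kernel of a morphism of `Γ`-sheaves. -/
def ker : GammaSheaf σ := sub A (kernel.ι f.hom) (kernel_invariant f)

/-- The inclusion of the kernel. -/
def kerι : ker f ⟶ A := subι A (kernel.ι f.hom) (kernel_invariant f)

theorem kerι_comp : kerι f ≫ f = 0 := hom_ext (kernel.condition f.hom)

/-- The kernel of a morphism of `Γ`-sheaves is computed on the underlying sheaves. -/
def kerIsLimit : IsLimit (KernelFork.ofι (kerι f) (kerι_comp f)) :=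
  isLimitKernelFork _ (kernel.condition f.hom) (kernelIsKernel f.hom)

theorem hasKernels : HasKernels (GammaSheaf σ) where
  has_limit f := ⟨⟨_, kerIsLimit f⟩⟩

theorem cokernel_invariant (γ : Gamma σ) (b : B.sheaf.stalk γ.s)
    (hb : stalkMap (cokernel.π f.hom) γ.s b = 0) :
    stalkMap (cokernel.π f.hom) γ.r (B.act γ b) = 0 := by
  obtain ⟨a, rfl⟩ := exists_stalkMap_eq_of_exact (ShortComplex.exact_of_g_is_cokernel
    (ShortComplex.mk _ _ (cokernel.condition f.hom)) (cokernelIsCokernel f.hom)) b hb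
  dsimp only
  rw [← f.equivariant, stalkMap_eq_zero_of_comp_eq_zero (cokernel.condition f.hom)]

/-- The cokernel of a morphism of `Γ`-sheaves. -/
def coker : GammaSheaf σ := quot B (cokernel.π f.hom) (cokernel_invariant f)

/-- The projection to the cokernel. -/
def cokerπ : B ⟶ coker f := quotπ B (cokernel.π f.hom) (cokernel_invariant f)

theorem comp_cokerπ : f ≫ cokerπ f = 0 := hom_ext (cokernel.condition f.hom)

/-- The cokernel of a morphism of `Γ`-sheaves is computed on the underlying sheaves. -/
def cokerIsColimit : IsColimit (CokernelCofork.ofπ (cokerπ f) (comp_cokerπ f)) :=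
  isColimitCokernelCofork _ (cokernel.condition f.hom) (cokernelIsCokernel f.hom)

theorem hasCokernels : HasCokernels (GammaSheaf σ) where
  has_colimit f := ⟨⟨_, cokerIsColimit f⟩⟩

end Kernel

/-- Exactness of the forgetful functor: the kernels and cokernels constructed above have the sheaf
kernels and cokernels as underlying objects. -/
instance : (forgetAction σ).PreservesHomology where
  preservesKernels _ _ f := preservesLimit_of_preserves_limit_cone (kerIsLimit f) <|
    (KernelFork.isLimitMapConeEquiv _ (forgetAction σ)).symm (kernelIsKernel f.hom)
  preservesCokernels _ _ f := preservesColimit_of_preserves_colimit_cocone (cokerIsColimit f) <|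
    (CokernelCofork.isColimitMapCoconeEquiv _ (forgetAction σ)).symm (cokernelIsCokernel f.hom)

/-- The sheaf kernel of `f` carries an action, so its inclusion is a morphism of `Γ`-sheaves killed
by `f` and must vanish. -/
theorem mono_hom {A B : GammaSheaf σ} (f : A ⟶ B) [Mono f] : Mono f.hom :=
  Preadditive.mono_of_isZero_kernel _ <| (IsZero.iff_id_eq_zero _).2 <| by
    rw [← cancel_mono (kernel.ι f.hom), Category.id_comp, zero_comp]
    exact congrArg Hom.hom ((cancel_mono f).1 ((kerι_comp f).trans zero_comp.symm))

theorem epi_hom {A B : GammaSheaf σ} (f : A ⟶ B) [Epi f] : Epi f.hom :=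
  Preadditive.epi_of_isZero_cokernel _ <| (IsZero.iff_id_eq_zero _).2 <| by
    rw [← cancel_epi (cokernel.π f.hom), Category.comp_id, comp_zero]
    exact congrArg Hom.hom ((cancel_epi f).1 ((comp_cokerπ f).trans comp_zero.symm))

/-- A monomorphism is the kernel of its cokernel in sheaves; that cokernel carries an action, and
the kernel property lifts by `isLimitKernelFork`. -/
theorem isNormalMonoCategory : IsNormalMonoCategory (GammaSheaf σ) where
  normalMonoOfMono f _ := by
    have := mono_hom f
    exact ⟨⟨_, cokerπ f, comp_cokerπ f, isLimitKernelFork _ (cokernel.condition f.hom)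
      (Abelian.monoIsKernelOfCokernel (CokernelCofork.ofπ _ (cokernel.condition f.hom))
        (cokernelIsCokernel f.hom))⟩⟩

theorem isNormalEpiCategory : IsNormalEpiCategory (GammaSheaf σ) where
  normalEpiOfEpi f _ := by
    have := epi_hom f
    exact ⟨⟨_, kerι f, kerι_comp f, isColimitCokernelCofork _ (kernel.condition f.hom)
      (Abelian.epiIsCokernelOfKernel (KernelFork.ofι _ (kernel.condition f.hom))
        (kernelIsKernel f.hom))⟩⟩

/-- The zero sheaf as a `Γ`-sheaf. -/
def zeroObj (σ : X → X) : GammaSheaf σ where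
  sheaf := 0
  act _ := 0
  act_unit x := by
    rw [← stalkMap_id, (isZero_zero (AbSheaf X)).eq_of_src (𝟙 _) 0, stalkMap_zero]
  act_mul _ _ _ := rfl
  continuous_act := by
    have hp : Continuous fun p : ActionDomain σ (0 : AbSheaf X) =>
        (p.arrow, AbSheaf.pt (0 : AbSheaf X) p.germ) := continuous_induced_dom
    exact continuous_zero _ (Gamma.continuous_r.comp (continuous_fst.comp hp))

theorem hasZeroObject : HasZeroObject (GammaSheaf σ) :=
  ⟨zeroObj σ, (IsZero.iff_id_eq_zero _).2
    (hom_ext ((isZero_zero (AbSheaf X)).eq_of_src (Y := (zeroObj σ).sheaf) _ _))⟩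

section DirectSum

variable {A B : GammaSheaf σ} {b : BinaryBicone A.sheaf B.sheaf}
  (hb : b.fst ≫ b.inl + b.snd ≫ b.inr = 𝟙 b.pt)

theorem stalkMap_fst {F G : AbSheaf X} (b : BinaryBicone F G) (x : X) (c : F.stalk x)
    (d : G.stalk x) : stalkMap b.fst x (stalkMap b.inl x c + stalkMap b.inr x d) = c := by
  rw [map_add, ← ConcreteCategory.comp_apply, ← ConcreteCategory.comp_apply, ← stalkMap_comp,
    ← stalkMap_comp, b.inl_fst, b.inr_fst, stalkMap_id, stalkMap_zero]
  exact add_zero c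

theorem stalkMap_snd {F G : AbSheaf X} (b : BinaryBicone F G) (x : X) (c : F.stalk x)
    (d : G.stalk x) : stalkMap b.snd x (stalkMap b.inl x c + stalkMap b.inr x d) = d := by
  rw [map_add, ← ConcreteCategory.comp_apply, ← ConcreteCategory.comp_apply, ← stalkMap_comp,
    ← stalkMap_comp, b.inl_snd, b.inr_snd, stalkMap_id, stalkMap_zero]
  exact zero_add d

/-- The action on the direct sum of two `Γ`-sheaves. -/
def directSumAct (A B : GammaSheaf σ) (b : BinaryBicone A.sheaf B.sheaf) (γ : Gamma σ) :
    AbSheaf.stalk b.pt γ.s ⟶ AbSheaf.stalk b.pt γ.r :=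
  stalkMap b.fst γ.s ≫ A.act γ ≫ stalkMap b.inl γ.r +
    stalkMap b.snd γ.s ≫ B.act γ ≫ stalkMap b.inr γ.r

theorem directSumAct_apply (b : BinaryBicone A.sheaf B.sheaf) (γ : Gamma σ)
    (a : AbSheaf.stalk b.pt γ.s) :
    directSumAct A B b γ a = stalkMap b.inl γ.r (A.act γ (stalkMap b.fst γ.s a)) +
      stalkMap b.inr γ.r (B.act γ (stalkMap b.snd γ.s a)) := rfl

theorem directSumAct_inl (b : BinaryBicone A.sheaf B.sheaf) (γ : Gamma σ)
    (a : A.sheaf.stalk γ.s) :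
    stalkMap b.inl γ.r (A.act γ a) = directSumAct A B b γ (stalkMap b.inl γ.s a) := by
  have h := ConcreteCategory.congr_hom (stalkMap_comp b.inl b.fst γ.s) a
  rw [b.inl_fst, stalkMap_id] at h
  rw [directSumAct_apply, stalkMap_eq_zero_of_comp_eq_zero b.inl_snd, map_zero, map_zero, add_zero]
  exact congrArg (fun c => stalkMap b.inl γ.r (A.act γ c)) h

theorem directSumAct_inr (b : BinaryBicone A.sheaf B.sheaf) (γ : Gamma σ)
    (a : B.sheaf.stalk γ.s) :
    stalkMap b.inr γ.r (B.act γ a) = directSumAct A B b γ (stalkMap b.inr γ.s a) := by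
  have h := ConcreteCategory.congr_hom (stalkMap_comp b.inr b.snd γ.s) a
  rw [b.inr_snd, stalkMap_id] at h
  rw [directSumAct_apply, stalkMap_eq_zero_of_comp_eq_zero b.inr_fst, map_zero, map_zero, zero_add]
  exact congrArg (fun c => stalkMap b.inr γ.r (B.act γ c)) h

/-- The direct sum of two `Γ`-sheaves. -/
def directSum : GammaSheaf σ where
  sheaf := b.pt
  act := directSumAct A B b
  act_unit x := by
    have h := stalkMap_add (b.fst ≫ b.inl) (b.snd ≫ b.inr) x
    rw [hb, stalkMap_id, stalkMap_comp, stalkMap_comp] at h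
    rw [h, directSumAct, A.act_unit, B.act_unit]
    exact congrArg₂ (· + ·) (congrArg _ (Category.id_comp _)) (congrArg _ (Category.id_comp _))
  act_mul {x y z m n} h₁ h₂ a := by
    rw [directSumAct_apply, directSumAct_apply, directSumAct_apply, stalkMap_fst, stalkMap_snd]
    exact congrArg₂ (· + ·) (congrArg _ (A.act_mul h₁ h₂ _)) (congrArg _ (B.act_mul h₁ h₂ _))
  continuous_act := by
    have hp : Continuous fun p : ActionDomain σ b.pt => (p.arrow, AbSheaf.pt b.pt p.germ) :=
      continuous_induced_dom
    have harrow := continuous_fst.comp hp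
    have hs := Gamma.continuous_s.comp harrow
    have hr := Gamma.continuous_r.comp harrow
    have hgerm := continuous_snd.comp hp
    exact continuous_add _ hr
      (continuous_stalkMap b.inl hr
        (continuous_act_comp A harrow (continuous_stalkMap b.fst hs hgerm)))
      (continuous_stalkMap b.inr hr
        (continuous_act_comp B harrow (continuous_stalkMap b.snd hs hgerm)))

/-- The direct sum of two `Γ`-sheaves with its projections and inclusions. -/
def directSumBicone : BinaryBicone A B where
  pt := directSum hb
  fst := ⟨b.fst, fun _ _ => stalkMap_fst b _ _ _⟩
  snd := ⟨b.snd, fun _ _ => stalkMap_snd b _ _ _⟩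
  inl := ⟨b.inl, directSumAct_inl b⟩
  inr := ⟨b.inr, directSumAct_inr b⟩
  inl_fst := hom_ext b.inl_fst
  inl_snd := hom_ext b.inl_snd
  inr_fst := hom_ext b.inr_fst
  inr_snd := hom_ext b.inr_snd

theorem hasBinaryBiproducts : HasBinaryBiproducts (GammaSheaf σ) where
  has_binary_biproduct A B := ⟨⟨_, isBinaryBilimitOfTotal
    (directSumBicone (b := BinaryBiproduct.bicone A.sheaf B.sheaf) biprod.total)
    (hom_ext biprod.total)⟩⟩

end DirectSum

theorem isAbelianCategory (σ : X → X) : IsAbelianCategory (GammaSheaf σ) where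
  hasFiniteProducts :=
    have := hasBinaryBiproducts (σ := σ)
    have := hasZeroObject (σ := σ)
    hasFiniteProducts_of_has_binary_and_terminal
  hasKernels := hasKernels
  hasCokernels := hasCokernels
  isNormalMonoCategory := isNormalMonoCategory
  isNormalEpiCategory := isNormalEpiCategory

end GammaSheaf

end

/-! ### Cocycles correspond to global sections. -/

theorem IsArrow.of_iterate {X : Type u} {σ : X → X} {x z : X} {k : ℕ} (h : σ^[k] x = z) :
    IsArrow σ x k z :=
  ⟨k, 0, h, by simp⟩

noncomputable section

namespace GammaSheaf

variable {X : Type u} [TopologicalSpace X] {σ : X → X}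

/-- The degree of the product is a separate variable `p`, so that the lemma applies to arrows whose
degree equals `m + n` only propositionally. The same device recurs below. -/
theorem act_act (A : GammaSheaf σ) {x y z : X} {m n p : ℤ} (h : IsArrow σ x m y)
    (h' : IsArrow σ y n z) (h'' : IsArrow σ x p z) (hp : m + n = p) (a : A.sheaf.stalk z) :
    A.act ⟨x, m, y, h⟩ (A.act ⟨y, n, z, h'⟩ a) = A.act ⟨x, p, z, h''⟩ a := by
  subst hp
  exact (A.act_mul h h' a).symm

theorem cocycle_mul {A : GammaSheaf σ} (f : cocycles A) {x y z : X} {m n p : ℤ}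
    (h : IsArrow σ x m y) (h' : IsArrow σ y n z) (h'' : IsArrow σ x p z) (hp : m + n = p) :
    f.1 ⟨x, p, z, h''⟩ = f.1 ⟨x, m, y, h⟩ + A.act ⟨x, m, y, h⟩ (f.1 ⟨y, n, z, h'⟩) := by
  subst hp
  exact f.2.2 h h'

theorem cocycle_unit {A : GammaSheaf σ} (f : cocycles A) (x : X) :
    f.1 (Gamma.unit σ x) = 0 := by
  have h := cocycle_mul f (IsArrow.refl σ x) (IsArrow.refl σ x) (IsArrow.refl σ x) (add_zero 0)
  have h' : A.act (Gamma.unit σ x) (f.1 (Gamma.unit σ x)) = f.1 (Gamma.unit σ x) :=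
    ConcreteCategory.congr_hom (A.act_unit x) _
  exact h'.symm.trans (left_eq_add.1 h)

/-- A cocycle is determined by its values at the arrows `(x, 1, σ x)`. -/
theorem cocycle_eq_zero {A : GammaSheaf σ} (f : cocycles A)
    (hf : ∀ x, f.1 (Gamma.shift σ x) = 0) : f = 0 := by
  have hk : ∀ (k : ℕ) (x z : X) (h : σ^[k] x = z), f.1 ⟨x, k, z, .of_iterate h⟩ = 0 := by
    intro k
    induction k with
    | zero => rintro x _ rfl; exact cocycle_unit f x
    | succ k ih =>
      intro x z h
      rw [cocycle_mul f (.shift σ x) (.of_iterate (k := k) (z := z) h) _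
        (by push_cast; ring), ih _ _ h, map_zero, add_zero]
      exact hf x
  refine Subtype.ext (funext fun ⟨x, m, y, h⟩ => ?_)
  obtain ⟨k, l, hkl, rfl⟩ := id h
  -- With `w = σ^k x = σ^l y`, the product `(x, k - l, y)(y, l, w)` is `(x, k, w)`, and `f` vanishes
  -- at the last two arrows.
  have := cocycle_mul f h (.of_iterate hkl.symm) (.of_iterate rfl) (sub_add_cancel _ _)
  rw [hk _ _ _ rfl, hk _ _ _ hkl.symm, map_zero, add_zero] at this
  exact this.symm

section Extend

variable (A : GammaSheaf σ) (g : ∀ x, A.sheaf.stalk x)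

/-- The value at `(x, k, σ^k x)` of the cocycle with value `g x` at `(x, 1, σ x)`. -/
def iterSum : ℕ → ∀ x, A.sheaf.stalk x
  | 0, _ => 0
  | k + 1, x => g x + A.act (Gamma.shift σ x) (iterSum k (σ x))

theorem iterSum_succ (k : ℕ) (x : X) :
    iterSum A g (k + 1) x = g x + A.act (Gamma.shift σ x) (iterSum A g k (σ x)) := rfl

/-- This is the cocycle identity for the product `(x, k, z)(z, j, σ^j z)`. -/
theorem iterSum_add (k j : ℕ) {x z : X} (h : σ^[k] x = z) :
    iterSum A g (k + j) x =
      iterSum A g k x + A.act ⟨x, k, z, .of_iterate h⟩ (iterSum A g j z) := by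
  induction k generalizing x with
  | zero =>
    subst h
    rw [Nat.zero_add]
    exact ((zero_add _).trans (ConcreteCategory.congr_hom (A.act_unit x) _)).symm
  | succ k ih =>
    rw [Nat.add_right_comm, iterSum_succ, iterSum_succ, ih (x := σ x) h, map_add, add_assoc]
    exact congrArg _ (congrArg _ (act_act A _ _ _ (by push_cast; ring) _))

/-- The value at `γ = (x, k - l, y)` with `σ^k x = σ^l y` of the cocycle with value `g x` at
`(x, 1, σ x)`. -/
def iterDiff (k l : ℕ) (γ : Gamma σ) : A.sheaf.stalk γ.r :=
  iterSum A g k γ.r + -A.act γ (iterSum A g l γ.s)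

/-- Both orbits pass through `w = σ^k x = σ^l y`. The additional terms are the same sum at `w`,
transported along `(x, k, w)` and along `γ (y, l, w)`, which are the same arrow, so they cancel. -/
theorem iterDiff_add {k l : ℕ} (j : ℕ) {γ : Gamma σ} (h : σ^[k] γ.r = σ^[l] γ.s)
    (hd : (k : ℤ) - l = γ.deg) :
    iterDiff A g (k + j) (l + j) γ = iterDiff A g k l γ := by
  rw [iterDiff, iterDiff, iterSum_add A g k j rfl, iterSum_add A g l j h.symm, map_add,
    act_act A γ.isArrow _ (.of_iterate rfl) (by rw [← hd, sub_add_cancel])]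
  abel

/-- Two presentations of one arrow have the same difference `k - l`, so one is obtained from the
other by adding the same `j` to both exponents. -/
theorem iterDiff_congr {k l k' l' : ℕ} {γ : Gamma σ} (h : σ^[k] γ.r = σ^[l] γ.s)
    (hd : (k : ℤ) - l = γ.deg) (h₁ : σ^[k'] γ.r = σ^[l'] γ.s) (hd₁ : (k' : ℤ) - l' = γ.deg) :
    iterDiff A g k l γ = iterDiff A g k' l' γ := by
  rcases le_total k k' with hk | hk
  · obtain ⟨j, rfl⟩ := Nat.exists_eq_add_of_le hk
    obtain rfl : l' = l + j := by omega
    exact (iterDiff_add A g j h hd).symm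
  · obtain ⟨j, rfl⟩ := Nat.exists_eq_add_of_le hk
    obtain rfl : l = l' + j := by omega
    exact iterDiff_add A g j h₁ hd₁

/-- The cocycle with value `g x` at `(x, 1, σ x)`, as a map. -/
def extendFun (γ : Gamma σ) : A.sheaf.stalk γ.r :=
  iterDiff A g γ.isArrow.choose γ.isArrow.choose_spec.choose γ

theorem extendFun_eq {k l : ℕ} {γ : Gamma σ} (h : σ^[k] γ.r = σ^[l] γ.s)
    (hd : (k : ℤ) - l = γ.deg) : extendFun A g γ = iterDiff A g k l γ :=
  iterDiff_congr A g γ.isArrow.choose_spec.choose_spec.1 γ.isArrow.choose_spec.choose_spec.2 h hd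

theorem extendFun_mul {x y z : X} {m n : ℤ} (h : IsArrow σ x m y) (h' : IsArrow σ y n z) :
    extendFun A g (Gamma.mul h h') =
      extendFun A g ⟨x, m, y, h⟩ + A.act ⟨x, m, y, h⟩ (extendFun A g ⟨y, n, z, h'⟩) := by
  obtain ⟨k, l, hkl, rfl⟩ := id h
  obtain ⟨k', l', hkl', rfl⟩ := id h'
  -- The presentations of the two factors are lengthened until both use the exponent `l + k'` at
  -- `y`; the sums at `y` then cancel.
  have h₁ : σ^[k + k'] x = σ^[l + k'] y := by
    rw [add_comm, Function.iterate_add_apply, hkl, ← Function.iterate_add_apply, add_comm]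
  have h₂ : σ^[l + k'] y = σ^[l + l'] z := by
    rw [Function.iterate_add_apply, hkl', ← Function.iterate_add_apply]
  rw [extendFun_eq A g (γ := Gamma.mul h h') (h₁.trans h₂) (by push_cast; ring),
    extendFun_eq A g (γ := ⟨x, _, y, h⟩) h₁ (by push_cast; ring),
    extendFun_eq A g (γ := ⟨y, _, z, h'⟩) h₂ (by push_cast; ring),
    iterDiff, iterDiff, iterDiff, map_add, map_neg, A.act_mul h h']
  abel

variable {A g}

theorem continuous_iterSum (hσ : Continuous σ) (hg : Continuous fun x => A.sheaf.pt (g x))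
    (k : ℕ) : Continuous fun x => A.sheaf.pt (iterSum A g k x) := by
  induction k with
  | zero => exact continuous_zero _ continuous_id
  | succ k ih =>
    exact continuous_add _ continuous_id hg
      (continuous_act_comp A (Gamma.continuous_shift hσ) (ih.comp hσ))

/-- For fixed `k` and `l` the formula `iterDiff` is continuous on all of `Γ`, and it computes the
cocycle on the whole basic open set of arrows presented by `k` and `l`. -/
theorem continuous_extendFun (hσ : Continuous σ) (hg : Continuous fun x => A.sheaf.pt (g x)) :
    Continuous fun γ => A.sheaf.pt (extendFun A g γ) := by
  rw [continuous_iff_continuousAt]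
  intro γ₀
  obtain ⟨k, l, h, hd⟩ := γ₀.isArrow
  have hc : Continuous fun γ : Gamma σ => A.sheaf.pt (iterDiff A g k l γ) :=
    continuous_add _ Gamma.continuous_r ((continuous_iterSum hσ hg k).comp Gamma.continuous_r)
      (continuous_neg _ Gamma.continuous_r (continuous_act_comp A continuous_id
        ((continuous_iterSum hσ hg l).comp Gamma.continuous_s)))
  refine hc.continuousAt.congr ?_
  have ho : IsOpen (Gamma.basicSet σ Set.univ k l Set.univ) :=
    isOpen_generateFrom_of_mem ⟨_, _, k, l, isOpen_univ, isOpen_univ, rfl⟩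
  filter_upwards [ho.mem_nhds ⟨trivial, trivial, h, hd⟩] with γ ⟨_, _, h, hd⟩
  rw [extendFun_eq A g h hd]

end Extend

theorem bijective_evalShiftHom (hσ : Continuous σ) (A : GammaSheaf σ) :
    Function.Bijective (evalShiftHom hσ A) := by
  refine ⟨(injective_iff_map_eq_zero _).2 fun f hf => cocycle_eq_zero f fun x => ?_, fun a => ?_⟩
  · have h : evalShiftFun hσ A f = 0 := hf
    rw [← germ_evalShiftFun hσ A f x, h, map_zero]
  · let g : ∀ x, A.sheaf.stalk x := fun x => A.sheaf.presheaf.germ ⊤ x trivial a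
    have hg : Continuous fun x => A.sheaf.pt (g x) :=
      (continuous_pt_iff A.sheaf continuous_id g).2 fun x =>
        ⟨⊤, a, trivial, .of_forall fun y => ⟨trivial, rfl⟩⟩
    refine ⟨⟨extendFun A g, continuous_extendFun hσ hg, extendFun_mul A g⟩,
      evalShiftFun_eq hσ A _ _ fun x => ?_⟩
    -- The presentation `k = 1`, `l = 0` of `(x, 1, σ x)` leaves the single term `g x`.
    refine Eq.symm ((extendFun_eq A g (k := 1) (l := 0) rfl (by simp)).trans ?_)
    simp only [iterDiff, iterSum, map_zero, neg_zero, add_zero]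
    rfl

instance (hσ : Continuous σ) : IsIso (evalShift hσ) := by
  rw [NatTrans.isIso_iff_isIso_app]
  exact fun A => (ConcreteCategory.isIso_iff_bijective _).2 (bijective_evalShiftHom hσ A)

end GammaSheaf

end

/-! ### Local sections of the range map of `Γ`. -/

open Filter

section Transport

variable {X : Type u} [TopologicalSpace X] {σ : X → X}

theorem isLocalHomeomorph_iterate (hσ : IsLocalHomeomorph σ) (k : ℕ) :
    IsLocalHomeomorph σ^[k] := by
  induction k with
  | zero => exact (Homeomorph.refl X).isLocalHomeomorph
  | succ k ih => exact ih.comp hσ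

/-- Near `x₀`, the map `τ` is continuous and `x ↦ (x, m, τ x)` is a continuous section of the range
map of `Γ`. -/
def IsTransport (σ : X → X) (m : ℤ) (τ : X → X) (x₀ : X) : Prop :=
  ∃ k l : ℕ, (k : ℤ) - l = m ∧ ∀ᶠ x in 𝓝 x₀, ContinuousAt τ x ∧ σ^[k] x = σ^[l] (τ x)

namespace IsTransport

variable {m n : ℤ} {τ τ' : X → X} {x₀ : X}

theorem continuousAt (h : IsTransport σ m τ x₀) : ContinuousAt τ x₀ := by
  obtain ⟨_, _, _, h⟩ := h
  exact h.self_of_nhds.1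

theorem eventually (h : IsTransport σ m τ x₀) : ∀ᶠ x in 𝓝 x₀, IsTransport σ m τ x := by
  obtain ⟨k, l, hkl, h⟩ := h
  exact h.eventually_nhds.mono fun x hx => ⟨k, l, hkl, hx⟩

theorem isArrow (h : IsTransport σ m τ x₀) : IsArrow σ x₀ m (τ x₀) := by
  obtain ⟨k, l, hkl, h⟩ := h
  exact ⟨k, l, h.self_of_nhds.2, hkl⟩

theorem refl (σ : X → X) (x₀ : X) : IsTransport σ 0 id x₀ :=
  ⟨0, 0, by simp, .of_forall fun _ => ⟨continuousAt_id, rfl⟩⟩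

theorem comp (h' : IsTransport σ n τ' (τ x₀)) (h : IsTransport σ m τ x₀) :
    IsTransport σ (m + n) (τ' ∘ τ) x₀ := by
  have hc := h.continuousAt
  obtain ⟨k, l, rfl, h⟩ := h
  obtain ⟨k', l', rfl, h'⟩ := h'
  refine ⟨k + k', l + l', by push_cast; ring, ?_⟩
  filter_upwards [h, hc.eventually h'] with x ⟨h₁, h₂⟩ ⟨h₃, h₄⟩
  refine ⟨h₃.comp h₁, ?_⟩
  rw [Nat.add_comm, Function.iterate_add_apply, h₂, ← Function.iterate_add_apply, Nat.add_comm,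
    Function.iterate_add_apply, h₄, ← Function.iterate_add_apply, Function.comp_apply]

/-- If `σ^k x = σ^l (τ x)` holds at `x₀`, then it holds near `x₀`. -/
theorem eventually_iterate_eq (hσ : IsLocalHomeomorph σ) (h : IsTransport σ m τ x₀) {k l : ℕ}
    (hkl : (k : ℤ) - l = m) (h₀ : σ^[k] x₀ = σ^[l] (τ x₀)) :
    ∀ᶠ x in 𝓝 x₀, σ^[k] x = σ^[l] (τ x) := by
  have hc := h.continuousAt
  obtain ⟨k', l', hkl', h⟩ := h
  rcases le_total k' k with hk | hk
  · obtain ⟨j, rfl⟩ := Nat.exists_eq_add_of_le' hk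
    obtain rfl : l = j + l' := by omega
    filter_upwards [h] with x ⟨_, hx⟩
    rw [Function.iterate_add_apply, hx, ← Function.iterate_add_apply]
  · obtain ⟨j, rfl⟩ := Nat.exists_eq_add_of_le' hk
    obtain rfl : l' = j + l := by omega
    -- Here `σ^j` has to be cancelled. It is injective near the common value `σ^k x₀ = σ^l (τ x₀)`,
    -- and both sides stay in that neighbourhood.
    obtain ⟨V, hV, hxV, hinj⟩ := (isLocalHomeomorph_iterate hσ j).isLocallyInjective (σ^[k] x₀)
    have h₁ : ∀ᶠ x in 𝓝 x₀, σ^[k] x ∈ V :=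
      (isLocalHomeomorph_iterate hσ k).continuous.continuousAt.eventually (hV.mem_nhds hxV)
    have h₂ : ∀ᶠ x in 𝓝 x₀, σ^[l] (τ x) ∈ V :=
      ((isLocalHomeomorph_iterate hσ l).continuous.continuousAt.comp hc).eventually
        (hV.mem_nhds (show σ^[l] (τ x₀) ∈ V from h₀ ▸ hxV))
    filter_upwards [h, h₁, h₂] with x ⟨_, hx⟩ h₁ h₂
    refine hinj h₁ h₂ ?_
    rwa [← Function.iterate_add_apply, ← Function.iterate_add_apply]

/-- Local sections of `r` through the same arrow agree: one pair `k, l` serves both near `x₀`, and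
`σ^l` is injective near `τ x₀`. -/
theorem eventuallyEq (hσ : IsLocalHomeomorph σ) (h : IsTransport σ m τ x₀)
    (h' : IsTransport σ m τ' x₀) (h₀ : τ x₀ = τ' x₀) : τ =ᶠ[𝓝 x₀] τ' := by
  obtain ⟨k, l, hkl, hk⟩ := id h
  have hk' := h'.eventually_iterate_eq hσ hkl (by rw [← h₀]; exact hk.self_of_nhds.2)
  obtain ⟨V, hV, hxV, hinj⟩ := (isLocalHomeomorph_iterate hσ l).isLocallyInjective (τ x₀)
  filter_upwards [hk, hk', h.continuousAt.eventually (hV.mem_nhds hxV),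
    h'.continuousAt.eventually (hV.mem_nhds (h₀ ▸ hxV))] with x h₁ h₂ h₃ h₄
  exact hinj h₃ h₄ (h₁.2.symm.trans h₂)

end IsTransport

/-- Take `τ` to be `σ^k` followed by a local inverse of `σ^l` at the source of `γ`. -/
theorem exists_isTransport (hσ : IsLocalHomeomorph σ) (γ : Gamma σ) :
    ∃ τ, IsTransport σ γ.deg τ γ.r ∧ τ γ.r = γ.s := by
  obtain ⟨k, l, h, hkl⟩ := γ.isArrow
  have hl := isLocalHomeomorph_iterate hσ l
  have hk := (isLocalHomeomorph_iterate hσ k).continuous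
  let e := hl.localInverseAt (x := γ.s)
  have he : σ^[k] γ.r ∈ e.source := h ▸ hl.apply_self_mem_localInverseAt_source
  refine ⟨fun x => e (σ^[k] x), ⟨k, l, hkl, ?_⟩, ?_⟩
  · filter_upwards [hk.continuousAt.eventually (e.open_source.mem_nhds he)] with x hx
    exact ⟨(e.continuousAt hx).comp (f := σ^[k]) hk.continuousAt,
      (hl.apply_localInverseAt_of_mem hx).symm⟩
  · change e (σ^[k] γ.r) = γ.s
    rw [h]
    exact hl.localInverseAt_apply_self

/-- The arrows near `γ` are those of the form `(x, m, τ x)`. -/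
theorem eventually_isTransport (hσ : IsLocalHomeomorph σ) {γ : Gamma σ} {τ : X → X}
    (hτ : IsTransport σ γ.deg τ γ.r) (h₀ : τ γ.r = γ.s) :
    ∀ᶠ γ' in 𝓝 γ, IsTransport σ γ'.deg τ γ'.r ∧ τ γ'.r = γ'.s := by
  obtain ⟨k, l, hkl, h⟩ := id hτ
  obtain ⟨V, hV, hxV, hinj⟩ := (isLocalHomeomorph_iterate hσ l).isLocallyInjective γ.s
  have ho : IsOpen (Gamma.basicSet σ Set.univ k l V) :=
    isOpen_generateFrom_of_mem ⟨_, _, k, l, isOpen_univ, hV, rfl⟩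
  have hγ : γ ∈ Gamma.basicSet σ Set.univ k l V :=
    ⟨trivial, hxV, h₀ ▸ h.self_of_nhds.2, hkl⟩
  have hr := Gamma.continuous_r.continuousAt (x := γ)
  filter_upwards [ho.mem_nhds hγ, hr.eventually h, hr.eventually hτ.eventually,
    hr.eventually (hτ.continuousAt.eventually (hV.mem_nhds (h₀ ▸ hxV)))]
    with γ' ⟨_, h₁, h₂, h₃⟩ ⟨_, h₄⟩ h₅ h₆
  have hd : γ'.deg = γ.deg := h₃.symm.trans hkl
  exact ⟨hd ▸ h₅, hinj h₆ h₁ (h₄.symm.trans h₂)⟩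

/-- The section `x ↦ (x, m, τ x)` is continuous. -/
theorem eventually_of_isTransport (hσ : IsLocalHomeomorph σ) {γ : Gamma σ} {τ : X → X}
    (hτ : IsTransport σ γ.deg τ γ.r) (h₀ : τ γ.r = γ.s) {p : Gamma σ → Prop}
    (hp : ∀ᶠ γ' in 𝓝 γ, p γ') :
    ∀ᶠ x in 𝓝 γ.r, ∀ h : IsArrow σ x γ.deg (τ x), p ⟨x, γ.deg, τ x, h⟩ := by
  classical
  -- The value `γ` off the domain is irrelevant: near `γ.r` the triple is an arrow.
  let f : X → Gamma σ := fun x => if h : IsArrow σ x γ.deg (τ x) then ⟨x, γ.deg, τ x, h⟩ else γ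
  have hf : Tendsto f (𝓝 γ.r) (𝓝 γ) := by
    rw [TopologicalSpace.tendsto_nhds_generateFrom_iff]
    rintro _ ⟨U, V, k, l, hU, hV, rfl⟩ ⟨h₁, h₂, h₃, h₄⟩
    filter_upwards [hU.mem_nhds h₁, hτ.continuousAt.eventually (hV.mem_nhds (h₀ ▸ h₂)),
      hτ.eventually_iterate_eq hσ h₄ (h₀ ▸ h₃), hτ.eventually] with x h₅ h₆ h₇ h₈
    simp only [Set.mem_preimage, f, dif_pos h₈.isArrow]
    exact ⟨h₅, h₆, h₇, h₄⟩
  filter_upwards [hf.eventually hp] with x hx h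
  simpa only [f, dif_pos h] using hx

end Transport

/-! ### The Godement sheaf of families indexed by arrows. -/

noncomputable section

section StalkDesc

variable {X : Type u} [TopologicalSpace X] (F : AbSheaf X) {x : X} {G : AddCommGrpCat.{u}}
  (φ : ∀ U : Opens (TopCat.of X), x ∈ U → (F.presheaf.obj (op U) ⟶ G))
  (hφ : ∀ (U V : Opens (TopCat.of X)) (i : U ⟶ V) (hx : x ∈ U) (a : F.presheaf.obj (op V)),
    φ U hx (F.presheaf.map i.op a) = φ V (i.le hx) a)

/-- A compatible family of homomorphisms on sections as a cocone. -/
def stalkCocone :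
    Limits.Cocone ((OpenNhds.inclusion (X := TopCat.of X) x).op ⋙ F.presheaf) where
  pt := G
  ι :=
    { app := fun U => φ U.unop.1 U.unop.2
      naturality := fun U V i => by
        ext a
        exact hφ V.unop.1 U.unop.1 ((OpenNhds.inclusion (X := TopCat.of X) x).map i.unop)
          V.unop.2 a }

/-- The homomorphism on a stalk defined by a compatible family of homomorphisms on sections. -/
def stalkDesc : F.stalk x ⟶ G := Limits.colimit.desc _ (stalkCocone F φ hφ)

theorem stalkDesc_germ (U : Opens (TopCat.of X)) (hx : x ∈ U) (a : F.presheaf.obj (op U)) :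
    stalkDesc F φ hφ (F.presheaf.germ U x hx a) = φ U hx a :=
  ConcreteCategory.congr_hom (Limits.colimit.ι_desc (stalkCocone F φ hφ)
    (op (⟨U, hx⟩ : OpenNhds (X := TopCat.of X) x))) a

end StalkDesc

section Godement

variable {X : Type u} [TopologicalSpace X] (σ : X → X) (D : X → AddCommGrpCat.{u})

/-- The product of the `D (s γ)` over the arrows `γ` with range `x`. -/
abbrev Cofiber (x : X) : Type u := ∀ p : {p : ℤ × X // IsArrow σ x p.1 p.2}, D p.1.2

/-- The presheaf of families of elements of the `D (s γ)`, for all arrows `γ` with range in an open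
set. -/
def godementPresheaf : TopCat.Presheaf AddCommGrpCat.{u} (TopCat.of X) where
  obj U := AddCommGrpCat.of (∀ x : U.unop, Cofiber σ D x.1)
  map i := AddCommGrpCat.ofHom
    { toFun := fun f x => f ⟨x.1, i.unop.le x.2⟩
      map_zero' := rfl
      map_add' := fun _ _ => rfl }

/-- The sheaf of families of elements of the `D (s γ)`, for all arrows `γ` with range in an open
set. -/
def godement : AbSheaf X :=
  ⟨godementPresheaf σ D, (TopCat.Presheaf.isSheaf_iff_isSheaf_comp (forget AddCommGrpCat.{u})
    (godementPresheaf σ D)).2 (TopCat.Presheaf.toTypes_isSheaf (TopCat.of X) (Cofiber σ D))⟩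

variable {σ D}

/-- Sections of the Godement sheaf as functions. -/
def godementSection {U : Opens (TopCat.of X)} (f : ∀ x : U, Cofiber σ D x.1) :
    (godement σ D).presheaf.obj (op U) := f

/-- The value of a section of the Godement sheaf. -/
def value {U : Opens (TopCat.of X)} (f : (godement σ D).presheaf.obj (op U)) {x : X} (hx : x ∈ U)
    {m : ℤ} {z : X} (h : IsArrow σ x m z) : D z :=
  (show ∀ x : U, Cofiber σ D x.1 from f) ⟨x, hx⟩ ⟨(m, z), h⟩

theorem value_congr {U : Opens (TopCat.of X)} (f : (godement σ D).presheaf.obj (op U)) {x x' : X}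
    (hxx' : x = x') (hx : x ∈ U) (hx' : x' ∈ U) {m m' : ℤ} (hm : m = m') {z : X}
    (h : IsArrow σ x m z) (h' : IsArrow σ x' m' z) : value f hx h = value f hx' h' := by
  subst hxx' hm
  rfl

theorem godement_germ_ext {U V : Opens (TopCat.of X)} {f : (godement σ D).presheaf.obj (op U)}
    {g : (godement σ D).presheaf.obj (op V)} {x₀ : X} (hU : x₀ ∈ U) (hV : x₀ ∈ V)
    (h : ∀ᶠ x in 𝓝 x₀, ∀ (hU : x ∈ U) (hV : x ∈ V) (m : ℤ) (z : X) (h : IsArrow σ x m z),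
      value f hU h = value g hV h) :
    (godement σ D).presheaf.germ U x₀ hU f = (godement σ D).presheaf.germ V x₀ hV g := by
  obtain ⟨W, hW, hWo, hxW⟩ := eventually_nhds_iff.1 h
  refine TopCat.Presheaf.germ_ext (X := TopCat.of X) _ (U ⊓ V ⊓ ⟨W, hWo⟩) ⟨⟨hU, hV⟩, hxW⟩
    (homOfLE fun x hx => hx.1.1) (homOfLE fun x hx => hx.1.2) ?_
  exact funext fun x => funext fun ⟨(m, z), h⟩ =>
    hW x.1 x.2.2 x.2.1.1 x.2.1.2 m z h

variable (D) in
/-- The component of a germ of the Godement sheaf at an arrow. -/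
def evalArrow {x : X} {m : ℤ} {z : X} (h : IsArrow σ x m z) : (godement σ D).stalk x ⟶ D z :=
  stalkDesc (godement σ D)
    (fun U hx => AddCommGrpCat.ofHom (X := (godement σ D).presheaf.obj (op U))
      { toFun := fun f => value f hx h
        map_zero' := rfl
        map_add' := fun _ _ => rfl }) fun _ _ _ _ _ => rfl

theorem evalArrow_germ {U : Opens (TopCat.of X)} (f : (godement σ D).presheaf.obj (op U)) {x : X}
    (hx : x ∈ U) {m : ℤ} {z : X} (h : IsArrow σ x m z) :
    evalArrow D h ((godement σ D).presheaf.germ U x hx f) = value f hx h :=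
  stalkDesc_germ _ _ _ _ _ _

/-- A morphism of sheaves to the Godement sheaf is given by a family of homomorphisms from the
stalks. -/
def liftGodement {F : AbSheaf X}
    (ψ : ∀ {x : X} {m : ℤ} {z : X}, IsArrow σ x m z → (F.stalk x ⟶ D z)) : F ⟶ godement σ D where
  hom :=
    { app := fun U => AddCommGrpCat.ofHom (Y := (godement σ D).presheaf.obj U)
        { toFun := fun a => godementSection fun x p => ψ p.2 (F.presheaf.germ U.unop x.1 x.2 a)
          map_zero' := funext fun x => funext fun p =>
            map_zero (F.presheaf.germ U.unop x.1 x.2 ≫ ψ p.2).hom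
          map_add' := fun a b => funext fun x => funext fun p =>
            map_add (F.presheaf.germ U.unop x.1 x.2 ≫ ψ p.2).hom a b }
      naturality := fun U V i => by
        ext a
        refine funext fun x => funext fun ⟨(m, z), h⟩ => ?_
        exact congrArg (ψ h) (F.presheaf.germ_res_apply i.unop x.1 x.2 a) }

section

variable {F : AbSheaf X} (ψ : ∀ {x : X} {m : ℤ} {z : X}, IsArrow σ x m z → (F.stalk x ⟶ D z))

theorem value_liftGodement {U : Opens (TopCat.of X)} (a : F.presheaf.obj (op U)) {x : X}
    (hx : x ∈ U) {m : ℤ} {z : X} (h : IsArrow σ x m z) :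
    value ((liftGodement ψ).hom.app (op U) a) hx h = ψ h (F.presheaf.germ U x hx a) := rfl

theorem evalArrow_liftGodement {x : X} {m : ℤ} {z : X} (h : IsArrow σ x m z) (a : F.stalk x) :
    evalArrow D h (stalkMap (liftGodement ψ) x a) = ψ h a := by
  obtain ⟨U, hx, b, rfl⟩ := exists_germ F a
  rw [stalkMap_germ, evalArrow_germ, value_liftGodement]

end

theorem hom_godement_ext {F : AbSheaf X} {f g : F ⟶ godement σ D}
    (hfg : ∀ {x : X} {m : ℤ} {z : X} (h : IsArrow σ x m z) (a : F.stalk x),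
      evalArrow D h (stalkMap f x a) = evalArrow D h (stalkMap g x a)) : f = g := by
  refine Sheaf.hom_ext (NatTrans.ext (funext fun U => ?_))
  ext a
  refine funext fun x => funext fun ⟨(m, z), h⟩ => ?_
  have := hfg h (F.presheaf.germ U.unop x.1 x.2 a)
  rw [stalkMap_germ, stalkMap_germ, evalArrow_germ, evalArrow_germ] at this
  exact this

/-- A map to the Godement sheaf is a free choice of homomorphisms on stalks, so it extends along a
monomorphism by extending each of them, using that `D z` is injective. -/
instance injective_godement [∀ z, Injective (D z)] : Injective (godement σ D) where
  factors {F G} g f _ := by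
    have : ∀ x, Mono (stalkMap f x) := fun x =>
      (AddCommGrpCat.mono_iff_injective _).2 (stalkMap_injective f x)
    refine ⟨liftGodement fun {x _ _} h =>
      Injective.factorThru (stalkMap g x ≫ evalArrow D h) (stalkMap f x),
      hom_godement_ext fun {x _ _} h a => ?_⟩
    rw [stalkMap_comp, ConcreteCategory.comp_apply, evalArrow_liftGodement]
    exact ConcreteCategory.congr_hom
      (Injective.comp_factorThru (stalkMap g x ≫ evalArrow D h) (stalkMap f x)) a

end Godement

/-! ### The action on the Godement sheaf and injective `Γ`-sheaves. -/

section GodementAction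

variable {X : Type u} [TopologicalSpace X] {σ : X → X} {D : X → AddCommGrpCat.{u}}

open Classical in
/-- The translate of a section of the Godement sheaf along `x ↦ (x, m, τ x)`, extended by zero. -/
def translateFun (m : ℤ) (τ : X → X) (V : Opens (TopCat.of X))
    (f : (godement σ D).presheaf.obj (op V)) (x : X) : Cofiber σ D x := fun p =>
  if h : τ x ∈ V ∧ IsArrow σ x m (τ x) then value f h.1 (h.2.symm.comp p.2) else 0

theorem translateFun_add (m : ℤ) (τ : X → X) (V : Opens (TopCat.of X))
    (f g : (godement σ D).presheaf.obj (op V)) (x : X) :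
    translateFun m τ V (f + g) x = translateFun m τ V f x + translateFun m τ V g x := by
  funext p
  simp only [translateFun, Pi.add_apply]
  split_ifs
  · rfl
  · exact (add_zero _).symm

theorem translateFun_zero (m : ℤ) (τ : X → X) (V : Opens (TopCat.of X)) (x : X) :
    translateFun m τ V (0 : (godement σ D).presheaf.obj (op V)) x = 0 := by
  funext p
  simp only [translateFun, Pi.zero_apply]
  split_ifs
  · rfl
  · rfl

/-- The translation of sections of the Godement sheaf along `x ↦ (x, m, τ x)`. -/
def translate (m : ℤ) (τ : X → X) (V : Opens (TopCat.of X)) :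
    (godement σ D).presheaf.obj (op V) ⟶ (godement σ D).presheaf.obj (op ⊤) :=
  AddCommGrpCat.ofHom (X := (godement σ D).presheaf.obj (op V))
    (Y := (godement σ D).presheaf.obj (op ⊤))
    { toFun := fun f => godementSection fun x => translateFun m τ V f x.1
      map_zero' := funext fun x => translateFun_zero m τ V x.1
      map_add' := fun f g => funext fun x => translateFun_add m τ V f g x.1 }

theorem value_translate {m : ℤ} {τ : X → X} {V : Opens (TopCat.of X)}
    (f : (godement σ D).presheaf.obj (op V)) {x : X} (hV : τ x ∈ V) (h : IsArrow σ x m (τ x))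
    (hx : x ∈ (⊤ : Opens (TopCat.of X))) {n p : ℤ} {z : X} (h' : IsArrow σ x n z)
    (h'' : IsArrow σ (τ x) p z) (hp : -m + n = p) :
    value (translate m τ V f) hx h' = value f hV h'' := by
  subst hp
  exact dif_pos (c := τ x ∈ V ∧ IsArrow σ x m (τ x)) ⟨hV, h⟩

variable (hσ : IsLocalHomeomorph σ)

/-- The two extensions by zero can differ only where `τ x` leaves `U`, hence not near `x₀`. -/
theorem germ_translate_map {m : ℤ} {τ : X → X} {x₀ : X} (hτ : IsTransport σ m τ x₀)
    {U V : Opens (TopCat.of X)} (i : U ⟶ V) (hx : τ x₀ ∈ U)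
    (f : (godement σ D).presheaf.obj (op V)) :
    (godement σ D).presheaf.germ ⊤ x₀ (Opens.mem_top _)
        (translate m τ U ((godement σ D).presheaf.map i.op f)) =
      (godement σ D).presheaf.germ ⊤ x₀ (Opens.mem_top _) (translate m τ V f) := by
  refine godement_germ_ext _ _ ?_
  filter_upwards [hτ.eventually, hτ.continuousAt.eventually (U.isOpen.mem_nhds hx)]
    with x h₁ h₂ _ _ n z h
  rw [value_translate _ h₂ h₁.isArrow _ h (h₁.isArrow.symm.comp h) rfl,
    value_translate _ (i.le h₂) h₁.isArrow _ h (h₁.isArrow.symm.comp h) rfl]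
  rfl

/-- The action of an arrow on the Godement sheaf. -/
def godementAct (γ : Gamma σ) : (godement σ D).stalk γ.s ⟶ (godement σ D).stalk γ.r :=
  have h := (exists_isTransport hσ γ).choose_spec
  stalkDesc (godement σ D)
    (fun V _ => translate γ.deg (exists_isTransport hσ γ).choose V ≫
      (godement σ D).presheaf.germ ⊤ γ.r (Opens.mem_top _))
    fun _ _ i hx f => germ_translate_map h.1 i (by rw [h.2]; exact hx) f

/-- The action is defined with a chosen `τ`; by `IsTransport.eventuallyEq` any other transport
through `γ` gives the same germ. All later computations with the action rest on this. -/
theorem godementAct_germ {γ : Gamma σ} {τ : X → X} (hτ : IsTransport σ γ.deg τ γ.r)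
    (h₀ : τ γ.r = γ.s) {U V : Opens (TopCat.of X)} (hU : γ.s ∈ U) (hV : γ.r ∈ V)
    (f : (godement σ D).presheaf.obj (op U)) (g : (godement σ D).presheaf.obj (op V))
    (hfg : ∀ᶠ x in 𝓝 γ.r, ∀ (hU : τ x ∈ U) (hV : x ∈ V) (_ : IsArrow σ x γ.deg (τ x))
      (n p : ℤ) (z : X) (h : IsArrow σ x n z) (h' : IsArrow σ (τ x) p z), -γ.deg + n = p →
        value f hU h' = value g hV h) :
    godementAct hσ γ ((godement σ D).presheaf.germ U γ.s hU f) =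
      (godement σ D).presheaf.germ V γ.r hV g := by
  have h := (exists_isTransport hσ γ).choose_spec
  refine (stalkDesc_germ _ _ _ U hU f).trans ?_
  refine godement_germ_ext (g := g) (Opens.mem_top _) hV ?_
  filter_upwards [hτ.eventuallyEq hσ h.1 (h₀.trans h.2.symm), hτ.eventually, hfg,
    hτ.continuousAt.eventually (U.isOpen.mem_nhds (h₀ ▸ hU))] with x h₁ h₂ h₃ h₄ _ hV n z h
  have ha := h₂.isArrow
  have h₅ := h₃ h₄ hV ha n _ z h (ha.symm.comp h) rfl
  rw [← h₅]
  simp only [h₁] at h₄ ha ⊢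
  exact value_translate f h₄ ha _ h (ha.symm.comp h) rfl

theorem godementAct_germ_translate {γ : Gamma σ} {τ : X → X} (hτ : IsTransport σ γ.deg τ γ.r)
    (h₀ : τ γ.r = γ.s) {U : Opens (TopCat.of X)} (hU : γ.s ∈ U)
    (f : (godement σ D).presheaf.obj (op U)) :
    godementAct hσ γ ((godement σ D).presheaf.germ U γ.s hU f) =
      (godement σ D).presheaf.germ ⊤ γ.r (Opens.mem_top _) (translate γ.deg τ U f) :=
  godementAct_germ hσ hτ h₀ hU (Opens.mem_top _) f _ <|
    .of_forall fun _ hU _ ha _ _ _ h h' hp => (value_translate f hU ha _ h h' hp).symm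

variable (D) in
/-- The Godement sheaf as a `Γ`-sheaf. -/
def godementGamma : GammaSheaf σ where
  sheaf := godement σ D
  act := godementAct hσ
  act_unit x := by
    ext a
    obtain ⟨U, hU, f, rfl⟩ := exists_germ _ a
    refine godementAct_germ hσ (γ := Gamma.unit σ x) (τ := id) (.refl σ x) rfl hU hU f f ?_
    exact .of_forall fun y _ _ _ n p z h h' hp => value_congr f rfl _ _ (by simpa using hp.symm) _ _
  act_mul {x y z m n} h h' a := by
    obtain ⟨U, hU, f, rfl⟩ := exists_germ _ a
    obtain ⟨τ, hτ, h₀⟩ := exists_isTransport hσ ⟨x, m, y, h⟩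
    obtain ⟨τ', hτ', h₀'⟩ := exists_isTransport hσ ⟨y, n, z, h'⟩
    dsimp only at hτ h₀ hτ' h₀'
    have e₁ := godementAct_germ_translate (D := D) hσ (γ := ⟨y, n, z, h'⟩) hτ' h₀' hU f
    have e₂ := godementAct_germ_translate (D := D) hσ (γ := ⟨x, m, y, h⟩) hτ h₀
      (U := ⊤) (Opens.mem_top _) (translate n τ' U f)
    refine Eq.trans ?_ ((congrArg _ e₁).trans e₂).symm
    have hτ'' : IsTransport σ (m + n) (τ' ∘ τ) x := IsTransport.comp (h₀.symm ▸ hτ') hτ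
    refine godementAct_germ hσ (γ := Gamma.mul h h') hτ''
      ((congrArg τ' h₀).trans h₀') hU (Opens.mem_top _) f _ ?_
    filter_upwards [hτ.eventually,
      hτ.continuousAt.eventually (IsTransport.eventually (h₀.symm ▸ hτ'))]
      with t h₁ h₂ hU _ _ i j w k k' hj
    rw [value_translate _ (Opens.mem_top _) h₁.isArrow _ k (h₁.isArrow.symm.comp k) rfl]
    refine (value_translate (x := τ t) f hU h₂.isArrow _ _ _ ?_).symm
    rw [← hj]
    ring
  continuous_act := by
    rw [continuous_act_iff]
    intro γ₀ U f hU
    obtain ⟨τ, hτ, h₀⟩ := exists_isTransport hσ γ₀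
    -- Arrows near `γ₀` have the same degree and lie on the same local section `τ`, so one
    -- translated section represents the action of all of them.
    refine ⟨⊤, translate γ₀.deg τ U f, Opens.mem_top _, ?_⟩
    obtain ⟨k, l, h, hkl⟩ := γ₀.isArrow
    have ho : IsOpen (Gamma.basicSet σ Set.univ k l Set.univ) :=
      isOpen_generateFrom_of_mem ⟨_, _, k, l, isOpen_univ, isOpen_univ, rfl⟩
    filter_upwards [eventually_isTransport hσ hτ h₀,
      Gamma.continuous_s.continuousAt.eventually (U.isOpen.mem_nhds hU),
      ho.mem_nhds ⟨trivial, trivial, h, hkl⟩] with γ ⟨h₁, h₂⟩ hs ⟨_, _, _, h₃⟩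
    refine ⟨hs, Opens.mem_top _, ?_⟩
    rw [← hkl, h₃]
    exact godementAct_germ_translate hσ h₁ h₂ hs f

/-- The action is `(γ a)(η) = a(γ⁻¹ η)`, here at the unit `η`. Thus the components at units,
together with the action, determine all components. -/
theorem evalArrow_unit_act (γ : Gamma σ) (a : (godement σ D).stalk γ.s) :
    evalArrow D (IsArrow.refl σ γ.r) ((godementGamma D hσ).act γ a) =
      evalArrow D γ.isArrow.symm a := by
  obtain ⟨U, hU, f, rfl⟩ := exists_germ _ a
  obtain ⟨τ, hτ, h₀⟩ := exists_isTransport hσ γ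
  refine (congrArg _ (godementAct_germ_translate hσ hτ h₀ hU f)).trans ?_
  rw [evalArrow_germ, evalArrow_germ]
  have ha := hτ.isArrow
  rw [value_translate f (h₀ ▸ hU) ha _ _ (ha.symm.comp (.refl σ γ.r)) rfl]
  exact value_congr f h₀ _ _ (by simp) _ _

/-- Locally the action takes the section `b` to a section `c` along the arrows `(x, m, τ x)`. The
components to be compared are `ψ z` applied to translates of germs of `b` and `c`, and these
translates agree since the action is multiplicative. -/
theorem stalkMap_liftGodement_act {B : GammaSheaf σ} (ψ : ∀ x, B.sheaf.stalk x ⟶ D x)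
    {F : B.sheaf ⟶ godement σ D}
    (hF : F = liftGodement fun {x m z} h => B.act ⟨z, -m, x, h.symm⟩ ≫ ψ z)
    (γ : Gamma σ) (b : B.sheaf.stalk γ.s) :
    stalkMap F γ.r (B.act γ b) = godementAct hσ γ (stalkMap F γ.s b) := by
  obtain ⟨U, hU, b, rfl⟩ := exists_germ _ b
  obtain ⟨V, c, hV, hc⟩ := (continuous_act_iff B.sheaf B.act).1 B.continuous_act γ U b hU
  obtain ⟨τ, hτ, h₀⟩ := exists_isTransport hσ γ
  obtain ⟨_, _, h₁⟩ := hc.self_of_nhds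
  rw [h₁, stalkMap_germ, stalkMap_germ]
  refine (godementAct_germ hσ hτ h₀ hU hV _ _ ?_).symm
  filter_upwards [eventually_of_isTransport hσ hτ h₀ hc] with x hx hU hV ha n p z h h' hp
  obtain ⟨_, _, h₂⟩ := hx ha
  subst hF
  rw [value_liftGodement, value_liftGodement, ← h₂, ConcreteCategory.comp_apply,
    ConcreteCategory.comp_apply, act_act B h.symm ha h'.symm (by rw [← hp]; ring)]

/-- A morphism of `Γ`-sheaves to the Godement `Γ`-sheaf is given by a family of homomorphisms from
the stalks. -/
def liftGodementGamma {B : GammaSheaf σ} (ψ : ∀ x, B.sheaf.stalk x ⟶ D x) :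
    B ⟶ godementGamma D hσ where
  hom := liftGodement fun {x m z} h => B.act ⟨z, -m, x, h.symm⟩ ≫ ψ z
  equivariant := stalkMap_liftGodement_act hσ ψ rfl

theorem evalArrow_liftGodementGamma {B : GammaSheaf σ} (ψ : ∀ x, B.sheaf.stalk x ⟶ D x) {x z : X}
    {m : ℤ} (h : IsArrow σ x m z) (b : B.sheaf.stalk x) :
    evalArrow D h (stalkMap (liftGodementGamma hσ ψ).hom x b) =
      ψ z (B.act ⟨z, -m, x, h.symm⟩ b) :=
  evalArrow_liftGodement _ h b

/-- Only the unit components of `g` are extended, along the injective stalk maps of `f`.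
Equivariance of `f` and `g` carries the agreement from units to all arrows. -/
instance injective_godementGamma [∀ z, Injective (D z)] : Injective (godementGamma D hσ) where
  factors {A B} g f _ := by
    have := mono_hom f
    have : ∀ x, Mono (stalkMap f.hom x) := fun x =>
      (AddCommGrpCat.mono_iff_injective _).2 (stalkMap_injective f.hom x)
    let ψ : ∀ x, A.sheaf.stalk x ⟶ D x :=
      fun x => stalkMap g.hom x ≫ evalArrow D (IsArrow.refl σ x)
    refine ⟨liftGodementGamma hσ fun x => Injective.factorThru (ψ x) (stalkMap f.hom x),
      hom_ext (hom_godement_ext fun {x m z} h a => ?_)⟩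
    refine (congrArg (evalArrow D h)
      (ConcreteCategory.congr_hom (stalkMap_comp f.hom _ x) a)).trans ?_
    refine (evalArrow_liftGodementGamma hσ _ h _).trans ?_
    refine (congrArg _ (f.equivariant ⟨z, -m, x, h.symm⟩ a).symm).trans ?_
    refine (ConcreteCategory.congr_hom (Injective.comp_factorThru (ψ z) (stalkMap f.hom z))
      (A.act ⟨z, -m, x, h.symm⟩ a)).trans ?_
    refine (congrArg _ (g.equivariant ⟨z, -m, x, h.symm⟩ a)).trans ?_
    refine (evalArrow_unit_act hσ ⟨z, -m, x, h.symm⟩ _).trans ?_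
    have e : ∀ (n : ℤ) (h' : IsArrow σ x n z), n = m → evalArrow D h' = evalArrow D h := by
      rintro _ _ rfl; rfl
    exact ConcreteCategory.congr_hom (e _ _ (neg_neg m)) _

/-- The Godement `Γ`-sheaf of injective groups containing the stalks of a `Γ`-sheaf. -/
abbrev godementUnder (A : GammaSheaf σ) : GammaSheaf σ :=
  godementGamma (fun x => Injective.under (A.sheaf.stalk x)) hσ

/-- The embedding of a `Γ`-sheaf in a Godement `Γ`-sheaf. -/
def toGodementUnder (A : GammaSheaf σ) : A ⟶ godementUnder hσ A :=
  liftGodementGamma hσ fun x => Injective.ι (A.sheaf.stalk x)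

/-- The unit component of the map on stalks is the embedding of the stalk in an injective group, and
monomorphisms of sheaves are detected on stalks. -/
instance (A : GammaSheaf σ) : Mono (toGodementUnder hσ A) := by
  refine (forgetAction σ).mono_of_mono_map ?_
  have : ∀ x : TopCat.of X, Mono ((TopCat.Presheaf.stalkFunctor AddCommGrpCat.{u} x).map
      ((forgetAction σ).map (toGodementUnder hσ A)).hom) := fun x => by
    refine (AddCommGrpCat.mono_iff_injective _).2 ((injective_iff_map_eq_zero _).2 fun a ha => ?_)
    have h := evalArrow_liftGodementGamma hσ (fun x => Injective.ι (A.sheaf.stalk x))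
      (IsArrow.refl σ x) a
    have e : ∀ (n : ℤ) (h' : IsArrow σ x n x), n = 0 → A.act ⟨x, n, x, h'⟩ a = a := by
      rintro _ _ rfl
      exact ConcreteCategory.congr_hom (A.act_unit x) a
    rw [e _ _ neg_zero] at h
    refine (injective_iff_map_eq_zero _).1
      ((AddCommGrpCat.mono_iff_injective (Injective.ι (A.sheaf.stalk x))).1 inferInstance) a ?_
    rw [← h]
    exact (congrArg _ ha).trans (map_zero _)
  exact TopCat.Presheaf.mono_of_stalk_mono (X := TopCat.of X) _

theorem enoughInjectives (hσ : IsLocalHomeomorph σ) : EnoughInjectives (GammaSheaf σ) where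
  presentation A := ⟨{ J := godementUnder hσ A, f := toGodementUnder hσ A }⟩

/-- An injective `Γ`-sheaf splits off its Godement embedding, so its underlying sheaf is a retract
of an injective sheaf. -/
theorem preservesInjectiveObjects_forgetAction (hσ : IsLocalHomeomorph σ) :
    (forgetAction σ).PreservesInjectiveObjects where
  injective_obj {I} hI := by
    have : Injective ((forgetAction σ).obj (godementUnder hσ I)) := injective_godement
    let r : Retract I (godementUnder hσ I) :=
      { i := toGodementUnder hσ I
        r := Injective.factorThru (𝟙 I) (toGodementUnder hσ I)
        retract := Injective.comp_factorThru _ _ }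
    exact (r.map (forgetAction σ)).injective

end GodementAction

/-! ### Comparison of right derived functors. -/

theorem comp_eq_of_squares {E : Type*} [Category* E] {P P' H H' K K' R R' : E} {a : P ⟶ P'}
    {i : P ⟶ H} {j : P' ⟶ H'} {z : H ⟶ H'} {p : H ⟶ K} {q : H' ⟶ K'} {s : K ⟶ K'} {i' : K ⟶ R}
    {j' : K' ⟶ R'} {a' : R ⟶ R'}
    (h₁ : a ≫ j = i ≫ z) (h₂ : z ≫ q = p ≫ s) (h₃ : i' ≫ a' = s ≫ j') :
    a ≫ j ≫ q ≫ j' = (i ≫ p ≫ i') ≫ a' := by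
  rw [← Category.assoc a, h₁, Category.assoc, ← Category.assoc z, h₂, Category.assoc,
    Category.assoc, Category.assoc, h₃]

section DerivedComparison

variable {C D E : Type*} [Category* C] [Category* D] [Category* E] [Abelian C] [Abelian D]
  [Abelian E] (U : C ⥤ D) [U.Additive] [U.PreservesHomology] [U.PreservesInjectiveObjects]

/-- The image of an injective resolution under an exact functor preserving injective objects. -/
def mapInjectiveResolution {A : C} (I : InjectiveResolution A) : InjectiveResolution (U.obj A) where
  cocomplex := (U.mapHomologicalComplex _).obj I.cocomplex
  injective n := U.injective_obj (I.cocomplex.X n)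
  ι := (HomologicalComplex.singleMapHomologicalComplex U (ComplexShape.up ℕ) 0).inv.app A ≫
    (U.mapHomologicalComplex _).map I.ι
  quasiIso := inferInstance

theorem mapInjectiveResolution_ι_f_zero {A : C} (I : InjectiveResolution A) :
    (mapInjectiveResolution U I).ι.f 0 = U.map (I.ι.f 0) := by
  change ((HomologicalComplex.singleMapHomologicalComplex U (ComplexShape.up ℕ) 0).inv.app A).f 0 ≫
    U.map (I.ι.f 0) = _
  rw [HomologicalComplex.singleMapHomologicalComplex_inv_app_self]
  change (𝟙 _ ≫ U.map (𝟙 _)) ≫ U.map (I.ι.f 0) = _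
  rw [U.map_id, Category.comp_id, Category.id_comp]

variable [EnoughInjectives C] [EnoughInjectives D] {S : D ⥤ E} [S.Additive] {Z : C ⥤ E}
  [Z.Additive] (φ : Z ⟶ U ⋙ S)

/-- The comparison map of derived functors computed with an injective resolution. -/
def derivedComparison (n : ℕ) {A : C} (I : InjectiveResolution A) :
    (Z.rightDerived n).obj A ⟶ (S.rightDerived n).obj (U.obj A) :=
  (I.isoRightDerivedObj Z n).hom ≫
    HomologicalComplex.homologyMap
      ((NatTrans.mapHomologicalComplex φ (ComplexShape.up ℕ)).app I.cocomplex) n ≫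
    ((mapInjectiveResolution U I).isoRightDerivedObj S n).inv

/-- A lift `ψ` of `f` to the resolutions has image `U ψ` lifting `U f`. The claim pastes the
naturality squares of the two identifications with homology and of `φ`. -/
theorem derivedComparison_naturality (n : ℕ) {A B : C} (f : A ⟶ B) (I : InjectiveResolution A)
    (J : InjectiveResolution B) :
    (Z.rightDerived n).map f ≫ derivedComparison U φ n J =
      derivedComparison U φ n I ≫ (S.rightDerived n).map (U.map f) := by
  let ψ := InjectiveResolution.desc f J I
  have hψ : I.ι.f 0 ≫ ψ.f 0 = f ≫ J.ι.f 0 := InjectiveResolution.desc_commutes_zero f J I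
  have hψ' : (mapInjectiveResolution U I).ι.f 0 ≫ ((U.mapHomologicalComplex _).map ψ).f 0 =
      U.map f ≫ (mapInjectiveResolution U J).ι.f 0 := by
    rw [mapInjectiveResolution_ι_f_zero, mapInjectiveResolution_ι_f_zero]
    exact (U.map_comp _ _).symm.trans ((congrArg U.map hψ).trans (U.map_comp _ _))
  have h₁ := InjectiveResolution.isoRightDerivedObj_hom_naturality f I J ψ hψ Z n
  have h₂ := InjectiveResolution.isoRightDerivedObj_inv_naturality (U.map f)
    (mapInjectiveResolution U I) (mapInjectiveResolution U J)
    ((U.mapHomologicalComplex _).map ψ) hψ' S n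
  have h₃ := congrArg (fun g => HomologicalComplex.homologyMap g n)
    ((NatTrans.mapHomologicalComplex φ (ComplexShape.up ℕ)).naturality ψ)
  simp only [HomologicalComplex.homologyMap_comp] at h₃
  exact comp_eq_of_squares h₁ h₃ h₂

/-- The map `f` lifts the identity of `U A` between two injective resolutions, so it induces the
canonical identification of their homologies after applying `S`. -/
theorem derivedComparison_comp (n : ℕ) {A : C} (I : InjectiveResolution A)
    (J : InjectiveResolution (U.obj A))
    (f : (U.mapHomologicalComplex (ComplexShape.up ℕ)).obj I.cocomplex ⟶ J.cocomplex)
    (hf : U.map (I.ι.f 0) ≫ f.f 0 = J.ι.f 0) :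
    derivedComparison U φ n I ≫ (J.isoRightDerivedObj S n).hom =
      (I.isoRightDerivedObj Z n).hom ≫
        HomologicalComplex.homologyMap
          ((NatTrans.mapHomologicalComplex φ (ComplexShape.up ℕ)).app I.cocomplex) n ≫
        HomologicalComplex.homologyMap
          ((S.mapHomologicalComplex (ComplexShape.up ℕ)).map f) n := by
  have h := InjectiveResolution.isoRightDerivedObj_hom_naturality (𝟙 (U.obj A))
    (mapInjectiveResolution U I) J f (by
      rw [mapInjectiveResolution_ι_f_zero]
      exact hf.trans (Category.id_comp _).symm) S n
  rw [CategoryTheory.Functor.map_id, Category.id_comp, ← Iso.inv_comp_eq] at h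
  exact (Category.assoc _ _ _).trans
    (congrArg _ ((Category.assoc _ _ _).trans (congrArg _ h)))

/-- Naturality at the identity shows independence of the resolution, so that the isomorphism built
from chosen resolutions is given by the same formula for every `I`. -/
theorem derivedComparison_eq (n : ℕ) {A : C} (I J : InjectiveResolution A) :
    derivedComparison U φ n I = derivedComparison U φ n J := by
  have h := derivedComparison_naturality U φ n (𝟙 A) J I
  simpa using h

instance [IsIso φ] (n : ℕ) {A : C} (I : InjectiveResolution A) :
    IsIso (derivedComparison U φ n I) := by
  have (n : ℕ) : IsIso
      (((NatTrans.mapHomologicalComplex φ (ComplexShape.up ℕ)).app I.cocomplex).f n) :=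
    inferInstanceAs (IsIso (φ.app (I.cocomplex.X n)))
  have := HomologicalComplex.Hom.isIso_of_components
    ((NatTrans.mapHomologicalComplex φ (ComplexShape.up ℕ)).app I.cocomplex)
  have : IsIso (HomologicalComplex.homologyMap
      ((NatTrans.mapHomologicalComplex φ (ComplexShape.up ℕ)).app I.cocomplex) n) :=
    inferInstance
  exact IsIso.comp_isIso' inferInstance (IsIso.comp_isIso' this (Iso.isIso_inv _))

/-- The isomorphism of right derived functors induced by an isomorphism `φ : Z ≅ U ⋙ S`, for an
exact functor `U` preserving injective objects. -/
def rightDerivedCompIso [IsIso φ] (n : ℕ) : Z.rightDerived n ≅ U ⋙ S.rightDerived n :=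
  NatIso.ofComponents (fun A => asIso (derivedComparison U φ n (injectiveResolution A)))
    fun f => derivedComparison_naturality U φ n f _ _

theorem rightDerivedCompIso_hom_app [IsIso φ] (n : ℕ) {A : C} (I : InjectiveResolution A) :
    (rightDerivedCompIso U φ n).hom.app A = derivedComparison U φ n I :=
  derivedComparison_eq U φ n _ I

end DerivedComparison

end

end LocalHomeoGroupoid

theorem theorem2p2 {X : Type u} [TopologicalSpace X] [T2Space X] [LocallyCompactSpace X]
    [SecondCountableTopology X] (σ : X → X) (hσ : IsLocalHomeomorph σ) :
    ∃ (hab : IsAbelianCategory (GammaSheaf σ)) (_ : EnoughInjectives (GammaSheaf σ)),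
      letI : Abelian (GammaSheaf σ) := hab.abelian
      ∀ n : ℕ, ∃ θ : (cocycleFunctor σ).rightDerived n ≅
          forgetAction σ ⋙ (globalSections X).rightDerived n,
        ∀ (A : GammaSheaf σ) (I : InjectiveResolution A) (J : InjectiveResolution A.sheaf),
          (∃ f : ((forgetAction σ).mapHomologicalComplex (ComplexShape.up ℕ)).obj I.cocomplex ⟶
              J.cocomplex,
            (forgetAction σ).map (I.ι.f 0) ≫ f.f 0 = J.ι.f 0) ∧
          ∀ f : ((forgetAction σ).mapHomologicalComplex (ComplexShape.up ℕ)).obj I.cocomplex ⟶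
              J.cocomplex,
            (forgetAction σ).map (I.ι.f 0) ≫ f.f 0 = J.ι.f 0 →
            θ.hom.app A ≫ (J.isoRightDerivedObj (globalSections X) n).hom =
              (I.isoRightDerivedObj (cocycleFunctor σ) n).hom ≫
                HomologicalComplex.homologyMap
                  ((NatTrans.mapHomologicalComplex (evalShift hσ.continuous)
                    (ComplexShape.up ℕ)).app I.cocomplex) n ≫
                HomologicalComplex.homologyMap
                  (((globalSections X).mapHomologicalComplex (ComplexShape.up ℕ)).map f) n := by
  refine ⟨isAbelianCategory σ, enoughInjectives hσ, ?_⟩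
  let _ : Abelian (GammaSheaf σ) := (isAbelianCategory σ).abelian
  intro n
  have := enoughInjectives hσ
  have := preservesInjectiveObjects_forgetAction hσ
  refine ⟨rightDerivedCompIso (forgetAction σ) (evalShift hσ.continuous) n, fun A I J => ⟨?_, ?_⟩⟩
  · refine ⟨InjectiveResolution.desc (𝟙 A.sheaf) J (mapInjectiveResolution (forgetAction σ) I), ?_⟩
    rw [← mapInjectiveResolution_ι_f_zero]
    exact (InjectiveResolution.desc_commutes_zero _ _ _).trans (Category.id_comp _)
  · intro f hf
    rw [rightDerivedCompIso_hom_app _ _ n I]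
    exact derivedComparison_comp (forgetAction σ) (evalShift hσ.continuous) n I J f hf
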